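/- Theorem. Let $G$ be a finite graph, possibly with parallel edges but without loops. Let $F\subseteq E(G)$ be (the edge set of) an arbitrary forest, let $e_1<e_2<\dots<e_h$ be an ordering of the edges not in $F$, and fix an orientation $e_i=\overrightarrow{u_iv_i}$ of each of them. Notation. Let $H$ be a connected subgraph of $G$. A divisor on $H$ is a function $D:V(H)\to\mathbb Z$; $(q)$ denotes the divisor with value $1$ at $q$ and $0$ elsewhere. $D$ is a *break divisor* of $H$ if for some spanning tree $T$ of $H$ and some orientation of the edges of $H$ not in $T$, $D$ is the sum of the divisors $(x)$ over the heads $x$ of these edges. For an orientation $\mathcal O$ of $H$ put $D_{\mathcal O}=\sum_{x\in V(H)}(\operatorname{indeg}_{\mathcal O}(x)-1)(x)$. Edge ordering map. For a spanning tree $T$ of $H$ and an edge $f$ of $H$ not in $T$, let $C$ be the unique cycle in $T+f$, direct $C$ so that its smallest edge $e_i$ is traversed from $u_i$ to $v_i$, and orient $f$ as it is traversed in $C$. The edge ordering map sends $T$ to the sum of $(\text{head of }f)$ over all edges $f$ of $H$ not in $T$. Subroutine. Let $\mathrm{DTO}$ be any subroutine which, given a connected subgraph $H$ of $G$, a break divisor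 $D$ of $H$ and a vertex $q$ of $H$, outputs an orientation $\mathcal O$ of $H$ with $D=D_{\mathcal O}+(q)$. Inverse algorithm $\mathrm{Inv}(H,D)$. If $D=0$, output the edge set $E(H)$. Otherwise let $e_i$ be the smallest of the edges $e_1,\dots,e_h$ lying in $H$, let $\mathcal O=\mathrm{DTO}(H,D,v_i)$, and let $U$ be the set of vertices reachable from $u_i$ by directed paths of $\mathcal O$. - If $v_i\in U$, output $\mathrm{Inv}(H-e_i,\,D-(v_i))$. - If $v_i\notin U$, put $U^c=V(H)\setminus U$, let $D_R$ be the restriction of $D$ to $U^c$, and let $D_L$ be obtained from the restriction of $D$ to $U$ by subtracting $(x)$ for every edge $f\ne e_i$ of $H$ directed in $\mathcal O$ from a vertex of $U^c$ to a vertex $x\in U$. Output $\{e_i\}\cup\mathrm{Inv}(H[U],D_L)\cup\mathrm{Inv}(H[U^c],D_R)$. Claim. 1. A subroutine $\mathrm{DTO}$ as above exists. 2. For every such subroutine and every connected subgraph $H$ of $G$ (in particular $H=G$ if $G$ is connected): for every break divisor $D$ of $H$ the algorithm $\mathrm{Inv}(H,D)$ terminates, and its output is a spanning tree of $H$ which the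 edge ordering map sends to $D$; and for every spanning tree $T$ of $H$, the edge ordering map sends $T$ to a break divisor $D$ of $H$ and $\mathrm{Inv}(H,D)$ terminates with output $T$. 3. Consequently, for every connected subgraph $H$ of $G$, the edge ordering map is a bijection from the spanning trees of $H$ onto the break divisors of $H$. -/

import Mathlib

open scoped Graph

namespace EdgeOrdering

section Graphs

variable {V E : Type*}

/-- A graph is connected if it has a vertex and any two of its vertices are joined by a walk. -/
def Connected (G : Graph V E) : Prop :=
  V(G).Nonempty ∧ ∀ x ∈ V(G), ∀ y ∈ V(G), Relation.ReflTransGen G.Adj x y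

/-- A (simple) cycle of `G` together with a direction of traversal: the cyclically indexed
vertices are distinct, the edges are distinct, and `edge j` is traversed from `vert j` to
`vert (j + 1)`. In a loopless graph the length is at least two, and a pair of parallel edges
gives a cycle of length two. -/
structure DirectedCycle (G : Graph V E) where
  len : ℕ
  len_pos : 0 < len
  vert : ZMod len → V
  edge : ZMod len → E
  vert_injective : Function.Injective vert
  edge_injective : Function.Injective edge
  isLink : ∀ j, G.IsLink (edge j) (vert j) (vert (j + 1))

/-- `F` is the edge set of a forest of `G`. -/
def IsForest (G : Graph V E) (F : Set E) : Prop :=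
  F ⊆ E(G) ∧ IsEmpty (DirectedCycle (G.restrict F))

/-- `T` is the edge set of a spanning tree of `G`: the spanning subgraph with edge set `T` is
connected and has no cycle. -/
def IsSpanningTree (G : Graph V E) (T : Set E) : Prop :=
  T ⊆ E(G) ∧ Connected (G.restrict T) ∧ IsEmpty (DirectedCycle (G.restrict T))

/-- The divisor `(q)`: one chip at `q`. -/
noncomputable def chip (q : V) : V → ℤ := Set.indicator {q} 1

/-- `D` is a break divisor of `G`: for some spanning tree `T` and some choice of a head `η f`
among the ends of every edge `f` outside `T`, there are `#{f ∉ T : η f = x}` chips at each `x`.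
(A divisor on `G` is a function on the ambient type that vanishes outside `V(G)`.) -/
def IsBreakDivisor (G : Graph V E) (D : V → ℤ) : Prop :=
  ∃ T, IsSpanningTree G T ∧ ∃ η : E → V, (∀ f ∈ E(G) \ T, G.Inc f (η f)) ∧
    ∀ x, D x = ({f | f ∈ E(G) \ T ∧ η f = x}.ncard : ℤ)

/-- An orientation of a loopless graph, given by the head `O f` of every edge `f`. -/
def IsOrientation (G : Graph V E) (O : E → V) : Prop :=
  ∀ f ∈ E(G), G.Inc f (O f)

/-- The divisor `D_O = ∑ₓ (indeg x - 1) (x)` of an orientation `O` of `G`. -/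
noncomputable def orientationDivisor (G : Graph V E) (O : E → V) : V → ℤ :=
  V(G).indicator fun x => ({f | f ∈ E(G) ∧ O f = x}.ncard : ℤ) - 1

/-- The vertices that can be reached from `x` along a directed path of the orientation `O`. -/
def reachable (G : Graph V E) (O : E → V) (x : V) : Set V :=
  {y | Relation.ReflTransGen (fun a b => ∃ f, G.IsLink f a b ∧ O f = b) x y}

/-- The input of the edge ordering map: a forest of `G`, an ordering `e 0 < e 1 < ⋯` of the edges
outside the forest, and a reference orientation `u i → v i` of each `e i`. -/
structure EdgeOrder (G : Graph V E) where
  forest : Set E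
  isForest : IsForest G forest
  h : ℕ
  e : Fin h → E
  e_injective : Function.Injective e
  range_e : Set.range e = E(G) \ forest
  u : Fin h → V
  v : Fin h → V
  isLink : ∀ i, G.IsLink (e i) (u i) (v i)

variable {G : Graph V E}

/-- `i` is the index of the smallest edge in `S`. -/
def EdgeOrder.IsSmallest (data : EdgeOrder G) (S : Set E) (i : Fin data.h) : Prop :=
  IsLeast {j | data.e j ∈ S} i

/-- For a spanning tree `T` of `H` and an edge `f` of `H` outside `T`, the edge ordering map orients
`f` with head `x`: the cycle `C` in `T + f`, directed so that its smallest edge `e i` is traversed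
from `u i` to `v i`, traverses `f` towards `x`. -/
def EdgeOrder.Orients (data : EdgeOrder G) (H : Graph V E) (T : Set E) (f : E) (x : V) : Prop :=
  ∃ C : DirectedCycle (H.restrict (insert f T)),
    (∃ i, data.IsSmallest (Set.range C.edge) i ∧
      ∃ j, C.edge j = data.e i ∧ C.vert j = data.u i ∧ C.vert (j + 1) = data.v i) ∧
    ∃ k, C.edge k = f ∧ C.vert (k + 1) = x

/-- The edge ordering map on the spanning trees of `H`: one chip at the head of each edge outside
`T`. -/
noncomputable def EdgeOrder.edgeOrderingMap (data : EdgeOrder G) (H : Graph V E) (T : Set E) :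
    V → ℤ :=
  fun x => ({f | f ∈ E(H) \ T ∧ data.Orients H T f x}.ncard : ℤ)

/-- `sub` is a correct divisor-to-orientation subroutine on the connected subgraphs of `G`: given
a connected `H ≤ G`, a break divisor `D` of `H` and a vertex `q` of `H`, it outputs an orientation
`O` of `H` with `D = D_O + (q)`. Its behaviour on other inputs is arbitrary. -/
def IsDivisorToOrientation (G : Graph V E) (sub : Graph V E → (V → ℤ) → V → (E → V)) : Prop :=
  ∀ H ≤ G, Connected H → ∀ D, IsBreakDivisor H D → ∀ q ∈ V(H),
    IsOrientation H (sub H D q) ∧ D = orientationDivisor H (sub H D q) + chip q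

open Classical in
/-- The recursive inverse algorithm with subroutine `sub`, run on `(H, D)` with recursion depth
limited by the first argument. The value is `none` if the limit is exceeded or if the algorithm
gets stuck because `D ≠ 0` and `H` contains none of the ordered edges. -/
noncomputable def EdgeOrder.inverse (data : EdgeOrder G)
    (sub : Graph V E → (V → ℤ) → V → (E → V)) :
    ℕ → Graph V E → (V → ℤ) → Option (Set E)
  | 0, _, _ => none
  | n + 1, H, D =>
    if D = 0 then some E(H)
    else if hi : ∃ i, data.IsSmallest E(H) i then
      let i := hi.choose
      let O := sub H D (data.v i)
      let U := reachable H O (data.u i)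
      if data.v i ∈ U then
        data.inverse sub n (H.deleteEdges {data.e i}) (D - chip (data.v i))
      else
        -- one chip is removed at `x` for each edge other than `e i` directed into `x` from outside `U`
        let DL : V → ℤ := U.indicator fun x =>
          D x - ({f | f ≠ data.e i ∧ ∃ w ∉ U, H.IsLink f w x ∧ O f = x}.ncard : ℤ)
        let DR : V → ℤ := (V(H) \ U).indicator D
        (data.inverse sub n (H.induce U) DL).bind fun TL =>
          (data.inverse sub n (H.induce (V(H) \ U)) DR).map fun TR =>
            {data.e i} ∪ TL ∪ TR
    else none

/-- The inverse algorithm terminates on `(H, D)` with output `T`: for every sufficiently large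
recursion depth it returns `T`. -/
def EdgeOrder.Outputs (data : EdgeOrder G) (sub : Graph V E → (V → ℤ) → V → (E → V))
    (H : Graph V E) (D : V → ℤ) (T : Set E) : Prop :=
  ∃ N, ∀ n ≥ N, data.inverse sub n H D = some T

end Graphs

end EdgeOrdering

/-!
Let `e` be the smallest edge of `H` in the ordering, directed from `u` to `v`. Write a break divisor
as `D = D_O + (v)` and let `U` be the set of vertices that `O` reaches from `u`. Among the
orientations with the same divisor, `O` has the largest number of heads in `U`, so `U` depends only
on `D`.

Let `D` be the image of a spanning tree `T`. Orienting `T` away from `v` and every other edge by its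
cycle gives a possible `O`. If `e` is not in `T`, then `e` is directed from `u` to `v`, so `v` lies
in `U`. If `e` is in `T`, then the cycle of each further edge of the fundamental cut of `e` leaves
the side of `u` through `e` and returns through that edge. Hence the whole cut is directed to the
side of `u`, and this side is `U`. So `D` determines whether `e` is in `T`, and in that case the cut
as well, and one continues with `H - e` or with the two sides of the cut. Conversely, this deletion
or splitting turns break divisors into break divisors, so the algorithm ends in a spanning tree.
-/

namespace EdgeOrdering

section Relations

variable {α : Type*} {r : α → α → Prop}

theorem exists_injective_path_of_reflTransGen {a b : α} (h : Relation.ReflTransGen r a b) :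
    ∃ (n : ℕ) (x : Fin (n + 1) → α), Function.Injective x ∧ x 0 = a ∧ x (Fin.last n) = b ∧
      ∀ k : Fin n, r (x k.castSucc) (x k.succ) := by
  induction h with
  | refl => exact ⟨0, fun _ => a, fun _ _ _ => Fin.ext (by omega), rfl, rfl, nofun⟩
  | @tail b c _ hbc ih =>
    obtain ⟨n, x, hinj, rfl, rfl, hstep⟩ := ih
    by_cases hc : c ∈ Set.range x
    · obtain ⟨m, rfl⟩ := hc
      refine ⟨m, x ∘ Fin.castLE m.is_lt, hinj.comp (Fin.castLE_injective _), rfl, rfl, fun k => ?_⟩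
      exact hstep (k.castLE (Nat.le_of_lt_succ m.is_lt))
    · refine ⟨n + 1, Fin.snoc x c, Fin.snoc_injective_of_injective hinj hc,
        Fin.snoc_castSucc (α := fun _ => α) c x 0, Fin.snoc_last (α := fun _ => α) c x,
        Fin.lastCases ?_ fun k => ?_⟩
      · simpa only [Fin.succ_last, Fin.snoc_castSucc, Fin.snoc_last] using hbc
      · simpa only [Fin.succ_castSucc, Fin.snoc_castSucc] using hstep k

theorem exists_rank_of_reflTransGen (r : α → α → Prop) (q : α) :
    ∃ rank : α → ℕ, ∀ x, Relation.ReflTransGen r q x → x ≠ q → ∃ t, r t x ∧ rank t < rank x := by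
  let layer (n : ℕ) : Set α := (fun s => {y | ∃ x ∈ s, r x y})^[n] {q}
  have layer_succ (n : ℕ) : layer (n + 1) = {y | ∃ x ∈ layer n, r x y} :=
    Function.iterate_succ_apply' _ _ _
  let rank (x : α) : ℕ := sInf {n | x ∈ layer n}
  refine ⟨rank, fun x hx hxq => ?_⟩
  have exists_layer : ∃ n, x ∈ layer n := by
    clear hxq
    induction hx with
    | refl => exact ⟨0, rfl⟩
    | tail _ h ih =>
      obtain ⟨n, hn⟩ := ih
      exact ⟨n + 1, by rw [layer_succ]; exact ⟨_, hn, h⟩⟩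
  have hmem : x ∈ layer (rank x) := Nat.sInf_mem (s := {n | x ∈ layer n}) exists_layer
  rcases hn : rank x with _ | n
  · rw [hn] at hmem
    exact absurd hmem hxq
  · rw [hn, layer_succ] at hmem
    obtain ⟨t, ht, htx⟩ := hmem
    exact ⟨t, htx, Nat.lt_succ_of_le (Nat.sInf_le ht)⟩

end Relations

variable {V E : Type*} {G H K : Graph V E}

/-- The edges of `H` with exactly one end in `X`. -/
def edgeBoundary (H : Graph V E) (X : Set V) : Set E :=
  {f | ∃ x ∈ X, ∃ y ∉ X, H.IsLink f x y}

theorem mem_edgeBoundary_iff {X : Set V} {f : E} {x y : V} (h : H.IsLink f x y) :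
    f ∈ edgeBoundary H X ↔ (x ∈ X ↔ y ∉ X) := by
  constructor
  · rintro ⟨a, ha, b, hb, hab⟩
    obtain ⟨rfl, rfl⟩ | ⟨rfl, rfl⟩ := hab.eq_and_eq_or_eq_and_eq h <;> tauto
  · intro hxy
    by_cases hx : x ∈ X
    · exact ⟨x, hx, y, hxy.1 hx, h⟩
    · exact ⟨y, by tauto, x, hx, h.symm⟩

theorem edgeBoundary_subset (H : Graph V E) (X : Set V) : edgeBoundary H X ⊆ E(H) :=
  fun _ ⟨_, _, _, _, h⟩ => h.edge_mem

theorem edgeBoundary_vertexSet_diff (H : Graph V E) (X : Set V) :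
    edgeBoundary H (V(H) \ X) = edgeBoundary H X :=
  Set.ext fun _ =>
    ⟨fun ⟨x, hx, y, hy, h⟩ => ⟨y, by_contra fun hyX => hy ⟨h.right_mem, hyX⟩, x, hx.2, h.symm⟩,
      fun ⟨x, hx, y, hy, h⟩ => ⟨y, ⟨h.right_mem, hy⟩, x, fun hxX => hxX.2 hx, h.symm⟩⟩

theorem edgeBoundary_restrict (H : Graph V E) (T : Set E) (X : Set V) :
    edgeBoundary (H.restrict T) X = T ∩ edgeBoundary H X := by
  ext f
  simp only [edgeBoundary, Graph.restrict_isLink, Set.mem_inter_iff, Set.mem_ofPred_eq]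
  tauto

theorem edgeSet_eq_union_edgeBoundary (H : Graph V E) (X : Set V) :
    E(H) = E(H.induce X) ∪ E(H.induce (V(H) \ X)) ∪ edgeBoundary H X := by
  ext f
  simp only [Graph.edgeSet_induce, Set.mem_union, Set.mem_ofPred_eq]
  constructor
  · intro hf
    obtain ⟨x, y, h⟩ := Graph.exists_isLink_of_mem_edgeSet hf
    have hx := h.left_mem
    have hy := h.right_mem
    rw [mem_edgeBoundary_iff h]
    by_cases hxX : x ∈ X <;> by_cases hyX : y ∈ X
    · exact .inl (.inl ⟨x, y, h, hxX, hyX⟩)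
    · tauto
    · tauto
    · exact .inl (.inr ⟨x, y, h, ⟨hx, hxX⟩, hy, hyX⟩)
  · rintro ((⟨x, y, h, -⟩ | ⟨x, y, h, -⟩) | ⟨x, -, y, -, h⟩) <;> exact h.edge_mem

theorem disjoint_edgeSet_induce_edgeBoundary (H : Graph V E) (X : Set V) :
    Disjoint E(H.induce X) (edgeBoundary H X) := by
  refine Set.disjoint_left.2 fun f hf hfX => ?_
  rw [Graph.edgeSet_induce] at hf
  obtain ⟨x, y, h, hx, hy⟩ := hf
  exact ((mem_edgeBoundary_iff h).1 hfX).1 hx hy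

theorem disjoint_edgeSet_induce (H : Graph V E) {X Y : Set V} (hXY : Disjoint X Y) :
    Disjoint E(H.induce X) E(H.induce Y) := by
  refine Set.disjoint_left.2 fun f hf hf' => ?_
  rw [Graph.edgeSet_induce] at hf hf'
  obtain ⟨x, y, h, hx, -⟩ := hf
  obtain ⟨x', y', h', hx', hy'⟩ := hf'
  obtain rfl | rfl := h.left_eq_or_eq h'
  · exact Set.disjoint_left.1 hXY hx hx'
  · exact Set.disjoint_left.1 hXY hx hy'

theorem eq_of_inc_of_mem_edgeBoundary {X : Set V} {f : E} {x y : V} (hf : f ∈ edgeBoundary H X)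
    (hx : H.Inc f x) (hy : H.Inc f y) (hxy : x ∈ X ↔ y ∈ X) : x = y := by
  obtain ⟨a, ha, b, hb, h⟩ := hf
  obtain rfl | rfl := hx.eq_or_eq_of_isLink h <;>
    obtain rfl | rfl := hy.eq_or_eq_of_isLink h <;> tauto

theorem mem_of_inc_of_notMem_edgeBoundary {X : Set V} {f : E} {x y : V}
    (hf : f ∉ edgeBoundary H X) (hfx : H.Inc f x) (hfy : H.Inc f y) (hx : x ∈ X) : y ∈ X := by
  obtain ⟨z, hz⟩ := hfx
  rw [mem_edgeBoundary_iff hz] at hf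
  obtain rfl | rfl := hfy.eq_or_eq_of_isLink hz <;> tauto

namespace DirectedCycle

/-- A cycle whose edges all link the same vertices in another graph, seen as a cycle there. -/
def transfer (C : DirectedCycle H)
    (h : ∀ j, K.IsLink (C.edge j) (C.vert j) (C.vert (j + 1))) : DirectedCycle K :=
  { C with isLink := h }

/-- The cycle traversed backwards. -/
def reverse (C : DirectedCycle H) : DirectedCycle H where
  len := C.len
  len_pos := C.len_pos
  vert j := C.vert (-j)
  edge j := C.edge (-j - 1)
  vert_injective _ _ h := neg_injective (C.vert_injective h)
  edge_injective _ _ h := neg_injective (sub_left_injective (C.edge_injective h))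
  isLink j := by
    have h := (C.isLink (-j - 1)).symm
    rw [sub_add_cancel] at h
    rwa [show -(j + 1) = -j - 1 by ring]

theorem exists_reverse_eq (C : DirectedCycle H) (j : ZMod C.len) :
    ∃ k, C.reverse.edge k = C.edge j ∧ C.reverse.vert k = C.vert (j + 1) ∧
      C.reverse.vert (k + 1) = C.vert j := by
  refine ⟨(-j - 1 : ZMod C.len), congrArg C.edge ?_, congrArg C.vert ?_, congrArg C.vert ?_⟩
  · ring
  · ring
  · change -(-j - 1 + 1) = j
    ring

theorem range_reverse_edge (C : DirectedCycle H) :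
    Set.range C.reverse.edge = Set.range C.edge := by
  refine Set.Subset.antisymm ?_ ?_
  · rintro _ ⟨j, rfl⟩
    exact ⟨_, rfl⟩
  · rintro _ ⟨j, rfl⟩
    obtain ⟨k, hk, -⟩ := C.exists_reverse_eq j
    exact ⟨k, hk⟩

/-- The cycle that closes up a path by an edge from its last vertex to its first one. -/
def ofPath {n : ℕ} {x : Fin (n + 1) → V} (hx : Function.Injective x) {g : Fin n → E}
    (hg : ∀ k, H.IsLink (g k) (x k.castSucc) (x k.succ)) {e : E} (he : e ∉ Set.range g)
    (hxe : H.IsLink e (x (Fin.last n)) (x 0)) : DirectedCycle H where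
  len := n + 1
  len_pos := n.succ_pos
  vert := x
  edge := Fin.snoc (α := fun _ => E) g e
  vert_injective := hx
  edge_injective := by
    refine Fin.snoc_injective_of_injective (fun k l hkl => ?_) he
    have hl := hg l
    rw [← hkl] at hl
    obtain ⟨h, -⟩ | ⟨h, h'⟩ := (hg k).eq_and_eq_or_eq_and_eq hl
    · exact Fin.castSucc_injective _ (hx h)
    · have h₁ := congrArg Fin.val (hx h)
      have h₂ := congrArg Fin.val (hx h')
      simp only [Fin.val_castSucc, Fin.val_succ] at h₁ h₂
      omega
  isLink := by
    change ∀ j : Fin (n + 1), H.IsLink (Fin.snoc (α := fun _ => E) g e j) (x j) (x (j + 1))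
    refine Fin.lastCases ?_ fun k => ?_
    · simpa only [Fin.snoc_last, Fin.last_add_one] using hxe
    · simpa only [Fin.snoc_castSucc, Fin.coeSucc_eq_succ] using hg k

theorem exists_of_reflTransGen (hKH : K ≤ H) {x y : V} {e : E}
    (hxy : Relation.ReflTransGen K.Adj x y) (he : H.IsLink e y x) (heK : e ∉ E(K)) :
    ∃ C : DirectedCycle H, e ∈ Set.range C.edge := by
  obtain ⟨n, x, hinj, rfl, rfl, hadj⟩ := exists_injective_path_of_reflTransGen hxy
  choose g hg using hadj
  have heg : e ∉ Set.range g := fun ⟨k, hk⟩ => heK (hk ▸ (hg k).edge_mem)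
  exact ⟨.ofPath hinj (fun k => (hg k).mono hKH) heg he, Fin.last n,
    Fin.snoc_last (α := fun _ => E) e g⟩

theorem exists_ne_mem_vert_of_notMem (C : DirectedCycle H) {X : Set V} {j : ZMod C.len}
    (hj : C.vert j ∈ X) (hj' : C.vert (j + 1) ∉ X) :
    ∃ k, k ≠ j ∧ C.vert k ∉ X ∧ C.vert (k + 1) ∈ X := by
  classical
  have : NeZero C.len := ⟨C.len_pos.ne'⟩
  let g (k : ZMod C.len) : ℤ := X.indicator 1 (C.vert k)
  have hsum : ∑ k, (g (k + 1) - g k) = 0 := by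
    rw [Finset.sum_sub_distrib, sub_eq_zero]
    exact Equiv.sum_comp (Equiv.addRight (1 : ZMod C.len)) g
  obtain ⟨k, -, hk⟩ := Finset.exists_pos_of_sum_zero_of_exists_nonzero _ hsum
    ⟨j, Finset.mem_univ _, by simp [g, hj, hj']⟩
  simp only [g, Set.indicator_apply, Pi.one_apply] at hk
  have hk' : C.vert k ∉ X ∧ C.vert (k + 1) ∈ X := by
    split_ifs at hk with h₁ h₂ <;> first | exact ⟨‹_›, ‹_›⟩ | norm_num at hk
  exact ⟨k, fun h => hk'.1 (h ▸ hj), hk'⟩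

theorem mem_edgeBoundary_iff (C : DirectedCycle H) {X : Set V} (j : ZMod C.len) :
    C.edge j ∈ edgeBoundary H X ↔ (C.vert j ∈ X ↔ C.vert (j + 1) ∉ X) :=
  EdgeOrdering.mem_edgeBoundary_iff (C.isLink j)

theorem exists_enters_of_leaves (C : DirectedCycle H) {X : Set V} {e f : E}
    (hX : edgeBoundary H X ⊆ {e, f}) {j : ZMod C.len} (hje : C.edge j = e)
    (hj : C.vert j ∈ X) (hj' : C.vert (j + 1) ∉ X) :
    ∃ k, C.edge k = f ∧ C.vert k ∉ X ∧ C.vert (k + 1) ∈ X := by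
  obtain ⟨k, hkj, hk, hk'⟩ := C.exists_ne_mem_vert_of_notMem hj hj'
  refine ⟨k, (hX ((C.mem_edgeBoundary_iff k).2 (by tauto))).resolve_left fun hke => ?_, hk, hk'⟩
  exact hkj (C.edge_injective (hke.trans hje.symm))

theorem exists_ne_mem_edgeBoundary (C : DirectedCycle H) {X : Set V} {j : ZMod C.len}
    (hj : C.edge j ∈ edgeBoundary H X) : ∃ k, k ≠ j ∧ C.edge k ∈ edgeBoundary H X := by
  simp only [C.mem_edgeBoundary_iff] at hj ⊢
  by_cases hjX : C.vert j ∈ X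
  · obtain ⟨k, hkj, hk⟩ := C.exists_ne_mem_vert_of_notMem hjX (hj.1 hjX)
    exact ⟨k, hkj, by tauto⟩
  · obtain ⟨k, hkj, hk⟩ := C.exists_ne_mem_vert_of_notMem (X := Xᶜ) hjX (not_not.2 (by tauto))
    exact ⟨k, hkj, by simp only [Set.mem_compl_iff] at hk; tauto⟩

theorem mem_range_edge_of_edgeBoundary_subset (C : DirectedCycle H) {X : Set V} {e f : E}
    (hX : edgeBoundary H X ⊆ {e, f}) (he : e ∈ Set.range C.edge ∩ edgeBoundary H X) :
    f ∈ Set.range C.edge ∩ edgeBoundary H X := by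
  obtain ⟨⟨j, rfl⟩, heX⟩ := he
  obtain ⟨k, hkj, hk⟩ := C.exists_ne_mem_edgeBoundary heX
  obtain rfl : C.edge k = f := (hX hk).resolve_left fun h => hkj (C.edge_injective h)
  exact ⟨⟨k, rfl⟩, hk⟩

theorem range_edge_subset (C : DirectedCycle H) : Set.range C.edge ⊆ E(H) := by
  rintro _ ⟨j, rfl⟩
  exact (C.isLink j).edge_mem

theorem vert_mem_iff_of_forall_notMem_edgeBoundary (C : DirectedCycle H) {X : Set V}
    (h : ∀ j, C.edge j ∉ edgeBoundary H X) (j : ZMod C.len) : C.vert j ∈ X ↔ C.vert 0 ∈ X := by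
  have hstep (j : ZMod C.len) : C.vert (j + 1) ∈ X ↔ C.vert j ∈ X := by
    have := h j
    rw [C.mem_edgeBoundary_iff] at this
    tauto
  have hnat (n : ℕ) : C.vert n ∈ X ↔ C.vert 0 ∈ X := by
    induction n with
    | zero => simp only [Nat.cast_zero]
    | succ n ih => rw [Nat.cast_succ, hstep, ih]
  have : NeZero C.len := ⟨C.len_pos.ne'⟩
  simpa only [ZMod.natCast_zmod_val] using hnat j.val

end DirectedCycle

theorem Connected.of_root {q : V} (hq : q ∈ V(H))
    (h : ∀ x ∈ V(H), Relation.ReflTransGen H.Adj q x) : Connected H := by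
  have : Std.Symm H.Adj := ⟨fun _ _ => Graph.Adj.symm⟩
  exact ⟨⟨q, hq⟩, fun x hx y hy => (Std.Symm.symm _ _ (h x hx)).trans (h y hy)⟩

theorem reflTransGen_adj_mono (h : H ≤ K) {x y : V} (hxy : Relation.ReflTransGen H.Adj x y) :
    Relation.ReflTransGen K.Adj x y :=
  hxy.lift id fun _ _ => .mono h

namespace IsSpanningTree

variable {S T : Set E}

theorem connected (hT : IsSpanningTree H T) : Connected H :=
  ⟨hT.2.1.1, fun x hx y hy =>
    reflTransGen_adj_mono Graph.restrict_le (hT.2.1.2 x hx y hy)⟩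

theorem exists_directedCycle (hT : IsSpanningTree H T) {f : E} (hf : f ∈ E(H) \ T) :
    ∃ C : DirectedCycle (H.restrict (insert f T)), f ∈ Set.range C.edge := by
  obtain ⟨x, y, h⟩ := Graph.exists_isLink_of_mem_edgeSet hf.1
  exact DirectedCycle.exists_of_reflTransGen (H.restrict_mono_right (Set.subset_insert f T))
    (hT.2.1.2 y h.right_mem x h.left_mem) ⟨Set.mem_insert f T, h⟩
    fun hfT => hf.2 hfT.2

theorem eq_of_subset (hS : IsSpanningTree H S) (hT : IsSpanningTree H T) (hST : S ⊆ T) :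
    S = T := by
  refine hST.antisymm fun f hf => by_contra fun hfS => ?_
  obtain ⟨C, -⟩ := hS.exists_directedCycle ⟨hT.1 hf, hfS⟩
  exact hT.2.2.false (C.transfer fun j =>
    (C.isLink j).mono (H.restrict_mono_right (Set.insert_subset hf hST)))

theorem exists_inter_edgeBoundary_eq (hT : IsSpanningTree H T) {e : E} {u v : V}
    (he : H.IsLink e u v) (heT : e ∈ T) :
    ∃ X ⊆ V(H), u ∈ X ∧ v ∉ X ∧ T ∩ edgeBoundary H X = {e} := by
  let X : Set V := {x | Relation.ReflTransGen (H.restrict (T \ {e})).Adj u x}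
  have hu : u ∈ X := .refl
  have hv : v ∉ X := fun hv => by
    obtain ⟨C, -⟩ := DirectedCycle.exists_of_reflTransGen (e := e)
      (H.restrict_mono_right (Set.sdiff_subset (s := T) (t := {e}))) hv
      ⟨heT, he.symm⟩ fun h => h.2.2 rfl
    exact hT.2.2.false C
  refine ⟨X, fun x hx => ?_, hu, hv, ?_⟩
  · obtain rfl | ⟨_, -, h⟩ := Relation.ReflTransGen.cases_tail hx
    · exact he.left_mem
    · exact h.right_mem
  · refine Set.Subset.antisymm ?_ (Set.singleton_subset_iff.2 ⟨heT, u, hu, v, hv, he⟩)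
    rintro f ⟨hfT, x, hx, y, hy, h⟩
    by_contra hfe
    exact hy (Relation.ReflTransGen.tail hx ⟨f, ⟨⟨hfT, hfe⟩, h⟩⟩)

theorem induce (hT : IsSpanningTree H T) {X : Set V} (hX : X ⊆ V(H)) {e : E}
    (hcut : T ∩ edgeBoundary H X = {e}) :
    IsSpanningTree (H.induce X) (T ∩ E(H.induce X)) := by
  obtain ⟨-, u, hu, v, -, he⟩ := hcut.ge (Set.mem_singleton e)
  have htree : (H.induce X).restrict (T ∩ E(H.induce X)) ≤ H.restrict T :=
    (Graph.restrict_mono_left (Graph.induce_le hX) _).trans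
      (H.restrict_mono_right Set.inter_subset_left)
  refine ⟨Set.inter_subset_right, .of_root (q := u) hu fun y hy => ?_, ⟨fun C =>
    hT.2.2.false (C.transfer fun j => (C.isLink j).mono htree)⟩⟩
  induction hT.2.1.2 u he.left_mem y (hX hy) with
  | refl => exact .refl
  | @tail x y _ hxy ih =>
    obtain ⟨f, hf⟩ := hxy
    obtain ⟨hfT, hf⟩ := hf
    by_cases hx : x ∈ X
    · have hfX : (H.induce X).IsLink f x y := ⟨hf, hx, hy⟩
      exact (ih hx).tail ⟨f, ⟨⟨hfT, hfX.edge_mem⟩, hfX⟩⟩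
    · have hfX : f ∈ T ∩ edgeBoundary H X := ⟨hfT, y, hy, x, hx, hf.symm⟩
      obtain rfl : f = e := by rwa [hcut] at hfX
      obtain rfl : y = u := eq_of_inc_of_mem_edgeBoundary hfX.2 hf.inc_right he.inc_left (by tauto)
      exact .refl

theorem induce_diff (hT : IsSpanningTree H T) {X : Set V} {e : E}
    (hcut : T ∩ edgeBoundary H X = {e}) :
    IsSpanningTree (H.induce (V(H) \ X)) (T ∩ E(H.induce (V(H) \ X))) :=
  hT.induce Set.sdiff_subset (by rwa [edgeBoundary_vertexSet_diff])

theorem eq_union_of_cut (hT : IsSpanningTree H T) {X : Set V} {e : E}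
    (hcut : T ∩ edgeBoundary H X = {e}) :
    T = {e} ∪ (T ∩ E(H.induce X)) ∪ (T ∩ E(H.induce (V(H) \ X))) := by
  conv_lhs =>
    rw [← Set.inter_eq_left.2 hT.1, edgeSet_eq_union_edgeBoundary H X, Set.inter_union_distrib_left,
      Set.inter_union_distrib_left, hcut]
  rw [Set.union_comm, Set.union_assoc]

end IsSpanningTree

theorem union_inter_edgeBoundary {S T : Set E} {X : Set V} {e : E} (he : e ∈ edgeBoundary H X)
    (hS : S ⊆ E(H.induce X)) (hT : T ⊆ E(H.induce (V(H) \ X))) :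
    ({e} ∪ S ∪ T) ∩ edgeBoundary H X = {e} := by
  have hS' := (disjoint_edgeSet_induce_edgeBoundary H X).mono_left hS
  have hT' := (disjoint_edgeSet_induce_edgeBoundary H (V(H) \ X)).mono_left hT
  rw [edgeBoundary_vertexSet_diff] at hT'
  rw [Set.union_inter_distrib_right, Set.union_inter_distrib_right, hS'.inter_eq, hT'.inter_eq,
    Set.union_empty, Set.union_empty, Set.inter_eq_left, Set.singleton_subset_iff]
  exact he

theorem isSpanningTree_union {S T : Set E} {X : Set V} (hX : X ⊆ V(H)) {e : E}
    (he : e ∈ edgeBoundary H X) (hS : IsSpanningTree (H.induce X) S)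
    (hT : IsSpanningTree (H.induce (V(H) \ X)) T) : IsSpanningTree H ({e} ∪ S ∪ T) := by
  obtain ⟨u, hu, v, hv, hlink⟩ := id he
  have hcut := union_inter_edgeBoundary he hS.1 hT.1
  have hle : H.induce X ≤ H := Graph.induce_le hX
  have hle' : H.induce (V(H) \ X) ≤ H := Graph.induce_le Set.sdiff_subset
  refine ⟨?_, .of_root (q := u) (hX hu) fun x hx => ?_, ⟨fun C => ?_⟩⟩
  · exact Set.union_subset (Set.union_subset (Set.singleton_subset_iff.2 hlink.edge_mem)
      (hS.1.trans hle.edgeSet_mono)) (hT.1.trans hle'.edgeSet_mono)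
  · by_cases hxX : x ∈ X
    · exact reflTransGen_adj_mono ((Graph.restrict_mono_left hle S).trans
        (H.restrict_mono_right fun f hf => .inl (.inr hf))) (hS.2.1.2 u hu x hxX)
    · exact .head (b := v) ⟨e, .inl (.inl rfl), hlink⟩ <|
        reflTransGen_adj_mono ((Graph.restrict_mono_left hle' T).trans
          (H.restrict_mono_right fun f hf => .inr hf))
          (hT.2.1.2 v ⟨hlink.right_mem, hv⟩ x ⟨hx, hxX⟩)
  · have hnotMem (j : ZMod C.len) : C.edge j ∉ edgeBoundary (H.restrict ({e} ∪ S ∪ T)) X := by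
      intro hj
      obtain ⟨k, hkj, hk⟩ := C.exists_ne_mem_edgeBoundary hj
      rw [edgeBoundary_restrict, hcut] at hj hk
      exact hkj (C.edge_injective (hk.trans hj.symm))
    have hvert := C.vert_mem_iff_of_forall_notMem_edgeBoundary hnotMem
    have hne (j : ZMod C.len) : C.edge j ≠ e := fun hj =>
      hnotMem j (by rw [edgeBoundary_restrict, hcut]; exact hj)
    by_cases hC : C.vert 0 ∈ X
    · refine hS.2.2.false (C.transfer fun j => ?_)
      obtain ⟨(hj | hj) | hj, hl⟩ := C.isLink j
      · exact absurd hj (hne j)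
      · exact ⟨hj, (hle.isLink_iff (hS.1 hj)).2 hl⟩
      · exact absurd ((hvert j).2 hC) ((hle'.isLink_iff (hT.1 hj)).2 hl).left_mem.2
    · refine hT.2.2.false (C.transfer fun j => ?_)
      obtain ⟨(hj | hj) | hj, hl⟩ := C.isLink j
      · exact absurd hj (hne j)
      · exact absurd ((hvert j).1 ((hle.isLink_iff (hS.1 hj)).2 hl).left_mem) hC
      · exact ⟨hj, (hle'.isLink_iff (hT.1 hj)).2 hl⟩

theorem isSpanningTree_of_bijOn {T : Set E} {O : E → V} {rank : V → ℕ} {q : V} (hq : q ∈ V(H))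
    (hO : Set.BijOn O T (V(H) \ {q}))
    (hrank : ∀ f ∈ T, ∃ t, H.IsLink f t (O f) ∧ rank t < rank (O f)) : IsSpanningTree H T := by
  refine ⟨fun f hf => ?_, .of_root hq fun x hx => ?_, ⟨fun C => ?_⟩⟩
  · obtain ⟨t, ht, -⟩ := hrank f hf
    exact ht.edge_mem
  · induction hn : rank x using Nat.strong_induction_on generalizing x with
    | _ n ih =>
      by_cases hxq : x = q
      · rw [hxq]
      · obtain ⟨f, hf, rfl⟩ := hO.surjOn ⟨hx, hxq⟩
        obtain ⟨t, ht, hlt⟩ := hrank f hf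
        exact (ih _ (hn ▸ hlt) t ht.left_mem rfl).tail ⟨f, hf, ht⟩
  -- Both edges of a cycle at a vertex of maximal rank would have that vertex as their head.
  · have : NeZero C.len := ⟨C.len_pos.ne'⟩
    obtain ⟨j, hj⟩ := Finite.exists_max fun j => rank (C.vert j)
    have head_eq {f y} (hf : (H.restrict T).IsLink f (C.vert j) y) (hy : rank y ≤ rank (C.vert j)) :
        O f = C.vert j ∧ y ≠ C.vert j := by
      obtain ⟨t, ht, hlt⟩ := hrank f hf.1
      obtain ⟨h₁, h₂⟩ | ⟨h₁, h₂⟩ := hf.2.eq_and_eq_or_eq_and_eq ht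
      · exact absurd (h₁ ▸ h₂ ▸ hlt) hy.not_gt
      · refine ⟨h₁.symm, fun h => ?_⟩
        rw [← h₂, ← h₁, h] at hlt
        exact hlt.false
    have hnext := C.isLink j
    have hprev := (C.isLink (j - 1)).symm
    rw [sub_add_cancel] at hprev
    obtain ⟨hnext_head, -⟩ := head_eq hnext (hj _)
    obtain ⟨hprev_head, hne⟩ := head_eq hprev (hj _)
    have hedge := hO.injOn hprev.1 hnext.1 (hprev_head.trans hnext_head.symm)
    exact hne (congrArg C.vert (C.edge_injective hedge))

section Reachable

variable {O : E → V} {q x y : V} {X : Set V} {f : E}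

theorem mem_reachable_self (H : Graph V E) (O : E → V) (q : V) : q ∈ reachable H O q :=
  .refl

theorem mem_reachable_of_isLink (hx : x ∈ reachable H O q) (hf : H.IsLink f x y) (hO : O f = y) :
    y ∈ reachable H O q :=
  Relation.ReflTransGen.tail hx ⟨f, hf, hO⟩

theorem reachable_trans (hx : x ∈ reachable H O q) : reachable H O x ⊆ reachable H O q :=
  fun _ hy => Relation.ReflTransGen.trans hx hy

theorem reachable_mono (hKH : K ≤ H) : reachable K O q ⊆ reachable H O q :=
  Relation.ReflTransGen.mono (fun _ _ ⟨f, hf, hO⟩ => ⟨f, hf.mono hKH, hO⟩) q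

theorem reachable_subset (hq : q ∈ X)
    (hX : ∀ f x y, H.IsLink f x y → O f = y → x ∈ X → y ∈ X) : reachable H O q ⊆ X := by
  intro x hx
  induction hx with
  | refl => exact hq
  | tail _ h ih =>
    obtain ⟨f, hf, hO⟩ := h
    exact hX f _ _ hf hO ih

theorem reachable_subset_vertexSet (hq : q ∈ V(H)) : reachable H O q ⊆ V(H) :=
  reachable_subset hq fun _ _ _ hf _ _ => hf.right_mem

theorem IsOrientation.head_mem_reachable (hO : IsOrientation H O)
    (hf : f ∈ edgeBoundary H (reachable H O q)) : O f ∈ reachable H O q := by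
  obtain ⟨x, hx, y, hy, hxy⟩ := hf
  obtain h | h := (hO f hxy.edge_mem).eq_or_eq_of_isLink hxy
  · rwa [h]
  · exact absurd (mem_reachable_of_isLink hx hxy h) hy

theorem IsOrientation.mono (hKH : K ≤ H) (hO : IsOrientation H O) : IsOrientation K O :=
  fun f hf => (Graph.IsSubgraph.inc_congr hKH hf).2 (hO f (hKH.edgeSet_mono hf))

theorem Connected.exists_reachable (hH : Connected H) (hq : q ∈ V(H)) :
    ∃ O, IsOrientation H O ∧ V(H) ⊆ reachable H O q := by
  obtain ⟨rank, hrank⟩ := exists_rank_of_reflTransGen H.Adj q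
  have exists_higher_end (f) (hf : f ∈ E(H)) :
      ∃ y, H.Inc f y ∧ ∀ x, H.IsLink f x y → rank x ≤ rank y := by
    obtain ⟨a, b, hab⟩ := Graph.exists_isLink_of_mem_edgeSet hf
    obtain h | h := le_total (rank a) (rank b)
    · exact ⟨b, hab.inc_right, fun x hx => by rwa [hx.left_unique hab]⟩
    · exact ⟨a, hab.inc_left, fun x hx => by rwa [hx.left_unique hab.symm]⟩
  have : Nonempty V := ⟨q⟩
  choose! O hO using exists_higher_end
  refine ⟨O, fun f hf => (hO f hf).1, fun x hx => ?_⟩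
  induction hn : rank x using Nat.strong_induction_on generalizing x with
  | _ n ih =>
    by_cases hxq : x = q
    · rw [hxq]
      exact mem_reachable_self H O q
    · obtain ⟨t, ⟨f, hf⟩, hlt⟩ := hrank x (hH.2 q hq x hx) hxq
      refine mem_reachable_of_isLink (ih _ (hn ▸ hlt) t hf.left_mem rfl) hf ?_
      obtain ⟨hinc, hmax⟩ := hO f hf.edge_mem
      refine (hinc.eq_or_eq_of_isLink hf).resolve_left fun hOt => ?_
      rw [hOt] at hmax
      exact (hmax x hf.symm).not_gt hlt

theorem exists_isSpanningTree_bijOn (hq : q ∈ V(H)) (h : V(H) ⊆ reachable H O q) :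
    ∃ T, IsSpanningTree H T ∧ Set.BijOn O T (V(H) \ {q}) := by
  obtain ⟨rank, hrank⟩ :=
    exists_rank_of_reflTransGen (fun x y => ∃ f, H.IsLink f x y ∧ O f = y) q
  have exists_parent (x : (V(H) \ {q} : Set V)) :
      ∃ f t, H.IsLink f t x ∧ O f = x ∧ rank t < rank x :=
    let ⟨t, ⟨f, hf, hO⟩, hlt⟩ := hrank x (h x.2.1) x.2.2
    ⟨f, t, hf, hO, hlt⟩
  choose parent pred hlink hhead hlt using exists_parent
  have hbij : Set.BijOn O (Set.range parent) (V(H) \ {q}) := by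
    refine ⟨?_, ?_, fun x hx => ⟨parent ⟨x, hx⟩, ⟨_, rfl⟩, hhead _⟩⟩
    · rintro _ ⟨x, rfl⟩
      exact (hhead x).symm ▸ x.2
    · rintro _ ⟨x, rfl⟩ _ ⟨y, rfl⟩ hxy
      rw [hhead, hhead] at hxy
      rw [Subtype.ext hxy]
  refine ⟨_, isSpanningTree_of_bijOn (rank := rank) hq hbij ?_, hbij⟩
  rintro _ ⟨x, rfl⟩
  exact ⟨pred x, (hhead x).symm ▸ hlink x, (hhead x).symm ▸ hlt x⟩

theorem IsSpanningTree.of_restrict {S T : Set E} (hS : IsSpanningTree (H.restrict T) S) :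
    IsSpanningTree H S := by
  have hST : S ⊆ T := fun f hf => (hS.1 hf).2
  have h := hS.2
  rw [Graph.restrict_restrict, Set.inter_eq_right.2 hST] at h
  exact ⟨fun f hf => (hS.1 hf).1, h⟩

theorem IsSpanningTree.exists_bijOn {T : Set E} (hT : IsSpanningTree H T) (hq : q ∈ V(H)) :
    ∃ O, IsOrientation (H.restrict T) O ∧ V(H) ⊆ reachable (H.restrict T) O q ∧
      Set.BijOn O T (V(H) \ {q}) := by
  obtain ⟨O, hO, hreach⟩ := hT.2.1.exists_reachable (q := q) hq
  obtain ⟨S, hS, hbij⟩ := exists_isSpanningTree_bijOn (H := H.restrict T) hq hreach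
  have hST : S = T := hS.of_restrict.eq_of_subset hT fun f hf => (hS.1 hf).2
  exact ⟨O, hO, hreach, hST ▸ hbij⟩

end Reachable

section HeadDivisor

/-- The divisor with one chip at `η f` for every edge `f ∈ S`. The break divisors and the values of
the edge ordering map have this form with `S = E(H) \ T`, and `D_O` has it up to the constant `-1`.
For infinite fibres the cardinality is `0`. -/
noncomputable def headDivisor (η : E → V) (S : Set E) : V → ℤ :=
  fun x => ({f | f ∈ S ∧ η f = x}.ncard : ℤ)

variable {η θ : E → V} {S T : Set E} {W : Set V}

theorem headDivisor_congr (h : Set.EqOn η θ S) : headDivisor η S = headDivisor θ S := by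
  ext x
  refine congrArg (fun A : Set E => (A.ncard : ℤ)) (Set.ext fun f => ?_)
  exact and_congr_right fun hf => by rw [h hf]

theorem headDivisor_union (hS : S.Finite) (hT : T.Finite) (hST : Disjoint S T) :
    headDivisor η (S ∪ T) = headDivisor η S + headDivisor η T := by
  ext x
  have hunion : {f | f ∈ S ∪ T ∧ η f = x} = {f | f ∈ S ∧ η f = x} ∪ {f | f ∈ T ∧ η f = x} :=
    Set.ext fun f => or_and_right
  rw [headDivisor, hunion, Set.ncard_union_eq (hST.mono (fun _ h => h.1) fun _ h => h.1)
    (hS.subset fun _ h => h.1) (hT.subset fun _ h => h.1), Nat.cast_add]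
  rfl

theorem headDivisor_diff_add (hS : S.Finite) (hTS : T ⊆ S) :
    headDivisor η (S \ T) + headDivisor η T = headDivisor η S := by
  rw [← headDivisor_union (hS.sdiff) (hS.subset hTS) Set.disjoint_sdiff_left,
    Set.sdiff_union_of_subset hTS]

theorem headDivisor_of_bijOn (h : Set.BijOn η S W) : headDivisor η S = W.indicator 1 := by
  classical
  ext x
  rw [headDivisor, Set.indicator_apply]
  split_ifs with hx
  · obtain ⟨f, hf, rfl⟩ := h.surjOn hx
    have : {g | g ∈ S ∧ η g = η f} = {f} :=
      Set.ext fun g => ⟨fun hg => h.injOn hg.1 hf hg.2, fun hg => by rw [hg]; exact ⟨hf, rfl⟩⟩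
    rw [this, Set.ncard_singleton, Nat.cast_one, Pi.one_apply]
  · have : {g | g ∈ S ∧ η g = x} = ∅ :=
      Set.eq_empty_of_forall_notMem fun g hg => hx (hg.2 ▸ h.mapsTo hg.1)
    rw [this, Set.ncard_empty, Nat.cast_zero]

theorem headDivisor_singleton (η : E → V) (f : E) : headDivisor η {f} = chip (η f) :=
  headDivisor_of_bijOn (Set.bijOn_singleton.2 rfl)

theorem support_headDivisor_subset (h : Set.MapsTo η S W) :
    Function.support (headDivisor η S) ⊆ W := by
  refine fun x => not_imp_comm.1 fun hx => ?_
  have : {f | f ∈ S ∧ η f = x} = ∅ :=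
    Set.eq_empty_of_forall_notMem fun f hf => hx (hf.2 ▸ h hf.1)
  rw [headDivisor, this, Set.ncard_empty, Nat.cast_zero]

theorem eq_empty_of_headDivisor_eq_zero (hS : S.Finite) (h : headDivisor η S = 0) : S = ∅ := by
  refine Set.eq_empty_of_forall_notMem fun f hf => ?_
  have hfiber : ({g | g ∈ S ∧ η g = η f}.ncard : ℤ) = 0 := congrFun h (η f)
  rw [Nat.cast_eq_zero, Set.ncard_eq_zero (hS.subset fun _ hg => hg.1)] at hfiber
  exact (hfiber ▸ (⟨hf, rfl⟩ : f ∈ {g | g ∈ S ∧ η g = η f}) : f ∈ (∅ : Set E))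

theorem ncard_setOf_head_mem_eq (hS : S.Finite) (hT : T.Finite)
    (h : headDivisor η S = headDivisor θ T) (W : Set V) :
    {f | f ∈ S ∧ η f ∈ W}.ncard = {f | f ∈ T ∧ θ f ∈ W}.ncard := by
  classical
  lift S to Finset E using hS
  lift T to Finset E using hT
  let heads : Finset V := {x ∈ S.image η ∪ T.image θ | x ∈ W}
  have card_eq_sum (ζ : E → V) (A : Finset E) (hA : A.image ζ ⊆ S.image η ∪ T.image θ) :
      ({f | f ∈ (A : Set E) ∧ ζ f ∈ W}.ncard : ℤ) = ∑ x ∈ heads, headDivisor ζ A x := by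
    have hcoe : {f | f ∈ (A : Set E) ∧ ζ f ∈ W} = ({f ∈ A | ζ f ∈ W} : Finset E) := by
      ext f
      simp
    have hmaps : ∀ f ∈ ({f ∈ A | ζ f ∈ W} : Finset E), ζ f ∈ heads := fun f hf =>
      Finset.mem_filter.2 ⟨hA (Finset.mem_image_of_mem ζ (Finset.mem_filter.1 hf).1),
        (Finset.mem_filter.1 hf).2⟩
    rw [hcoe, Set.ncard_coe_finset, Finset.card_eq_sum_card_fiberwise hmaps, Nat.cast_sum]
    refine Finset.sum_congr rfl fun x hx => ?_
    rw [headDivisor, ← Set.ncard_coe_finset]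
    congr 2
    ext f
    simp only [Finset.coe_filter, Finset.mem_filter, Set.mem_ofPred_eq, Finset.mem_coe]
    exact ⟨fun hf => ⟨hf.1.1, hf.2⟩, fun hf => ⟨⟨hf.1, hf.2 ▸ (Finset.mem_filter.1 hx).2⟩, hf.2⟩⟩
  have hsum := card_eq_sum η S Finset.subset_union_left
  rw [h, ← card_eq_sum θ T Finset.subset_union_right] at hsum
  exact_mod_cast hsum

theorem headDivisor_edgeSet_diff_eq (hE : E(H).Finite) (η : E → V) (X : Set V) (T : Set E) :
    headDivisor η (E(H) \ T) = headDivisor η (E(H.induce X) \ T) +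
      headDivisor η (E(H.induce (V(H) \ X)) \ T) + headDivisor η (edgeBoundary H X \ T) := by
  have hdisj := disjoint_edgeSet_induce_edgeBoundary H X
  have hdisj' := disjoint_edgeSet_induce_edgeBoundary H (V(H) \ X)
  have hdisj'' := disjoint_edgeSet_induce H (Set.disjoint_sdiff_right (s := X) (t := V(H)))
  rw [edgeBoundary_vertexSet_diff] at hdisj'
  rw [edgeSet_eq_union_edgeBoundary H X] at hE ⊢
  obtain ⟨⟨hX, hX'⟩, hcut⟩ := (Set.finite_union.1 hE).imp_left Set.finite_union.1
  rw [Set.union_sdiff_distrib, Set.union_sdiff_distrib,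
    headDivisor_union (hX.sdiff.union hX'.sdiff) hcut.sdiff,
    headDivisor_union hX.sdiff hX'.sdiff (hdisj''.mono Set.sdiff_subset Set.sdiff_subset)]
  rw [← Set.union_sdiff_distrib]
  exact (hdisj.union_left hdisj').mono Set.sdiff_subset Set.sdiff_subset

end HeadDivisor

section OrientationDivisor

variable {O O' η : E → V} {T : Set E} {q : V} {X : Set V} {e : E}

theorem IsOrientation.mapsTo (hO : IsOrientation H O) : Set.MapsTo O E(H) V(H) :=
  fun f hf => (hO f hf).vertex_mem

theorem IsOrientation.orientationDivisor_add (hO : IsOrientation H O) :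
    orientationDivisor H O + V(H).indicator 1 = headDivisor O E(H) := by
  classical
  ext x
  rw [Pi.add_apply, orientationDivisor, Set.indicator_apply, Set.indicator_apply]
  split_ifs with hx
  · exact sub_add_cancel _ _
  · rw [add_zero]
    exact (Function.notMem_support.1 fun h => hx (support_headDivisor_subset hO.mapsTo h)).symm

theorem indicator_diff_singleton_add_chip (hq : q ∈ X) :
    (X \ {q}).indicator 1 + chip q = X.indicator (1 : V → ℤ) := by
  rw [chip, Set.indicator_sdiff (Set.singleton_subset_iff.2 hq), sub_add_cancel]

theorem IsOrientation.add_chip_eq_headDivisor (hE : E(H).Finite) (hO : IsOrientation H O)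
    (hq : q ∈ V(H)) (hT : T ⊆ E(H)) (hbij : Set.BijOn O T (V(H) \ {q})) :
    orientationDivisor H O + chip q = headDivisor O (E(H) \ T) := by
  have hdiff := headDivisor_diff_add (η := O) hE hT
  rw [← hO.orientationDivisor_add, headDivisor_of_bijOn hbij,
    ← indicator_diff_singleton_add_chip hq] at hdiff
  linear_combination -hdiff

theorem IsOrientation.eq_deleteEdges_add_chip (hE : E(H).Finite) (hO : IsOrientation H O)
    (he : e ∈ E(H)) :
    orientationDivisor H O = orientationDivisor (H.deleteEdges {e}) O + chip (O e) := by
  have hdiff := headDivisor_diff_add (η := O) hE (Set.singleton_subset_iff.2 he)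
  have hdel := (hO.mono (Graph.deleteEdges_le (F := {e}))).orientationDivisor_add
  rw [Graph.edgeSet_deleteEdges, Graph.vertexSet_deleteEdges] at hdel
  rw [← hO.orientationDivisor_add, ← hdel, headDivisor_singleton] at hdiff
  linear_combination -hdiff

theorem IsOrientation.eq_induce_add_induce_add (hE : E(H).Finite) (hO : IsOrientation H O)
    (hX : X ⊆ V(H)) :
    orientationDivisor H O = orientationDivisor (H.induce X) O +
      orientationDivisor (H.induce (V(H) \ X)) O + headDivisor O (edgeBoundary H X) := by
  have hinduce := (hO.mono (Graph.induce_le hX)).orientationDivisor_add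
  have hinduce' := (hO.mono (Graph.induce_le (Set.sdiff_subset (s := V(H)) (t := X))))
    |>.orientationDivisor_add
  have hvertices : (V(H) \ X).indicator (1 : V → ℤ) = V(H).indicator 1 - X.indicator 1 :=
    Set.indicator_sdiff hX 1
  have hedges := headDivisor_edgeSet_diff_eq hE O X ∅
  simp only [Set.sdiff_empty] at hedges
  rw [Graph.vertexSet_induce] at hinduce hinduce'
  linear_combination hO.orientationDivisor_add + hedges - hinduce - hinduce' + hvertices

theorem IsSpanningTree.exists_isOrientation (hE : E(H).Finite) (hT : IsSpanningTree H T)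
    (hη : ∀ f ∈ E(H) \ T, H.Inc f (η f)) (hq : q ∈ V(H)) :
    ∃ O, IsOrientation H O ∧ headDivisor η (E(H) \ T) = orientationDivisor H O + chip q ∧
      V(H) ⊆ reachable (H.restrict T) O q ∧ Set.EqOn O η (E(H) \ T) := by
  classical
  obtain ⟨O, hO, hreach, hbij⟩ := hT.exists_bijOn hq
  let O' : E → V := fun f => if f ∈ T then O f else η f
  have hOT : Set.EqOn O' O T := fun f hf => if_pos hf
  have hOη : Set.EqOn O' η (E(H) \ T) := fun f hf => if_neg hf.2
  have hO' : IsOrientation H O' := fun f hf => by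
    by_cases hfT : f ∈ T
    · rw [hOT hfT]
      exact (hO f ⟨hf, hfT⟩).mono Graph.restrict_le
    · rw [hOη ⟨hf, hfT⟩]
      exact hη f ⟨hf, hfT⟩
  refine ⟨O', hO', ?_, hreach.trans ?_, hOη⟩
  · rw [hO'.add_chip_eq_headDivisor hE hq hT.1 (hbij.congr hOT.symm), headDivisor_congr hOη]
  · exact reachable_subset (mem_reachable_self _ _ _) fun f x y hf hy hx =>
      mem_reachable_of_isLink hx hf ((hOT hf.1).trans hy)

theorem reachable_subset_of_orientationDivisor_eq (hE : E(H).Finite) (hO : IsOrientation H O)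
    (hO' : IsOrientation H O') (h : orientationDivisor H O = orientationDivisor H O') (q : V) :
    reachable H O' q ⊆ reachable H O q := by
  set R := reachable H O q
  have hheads : headDivisor O' E(H) = headDivisor O E(H) := by
    rw [← hO.orientationDivisor_add, ← hO'.orientationDivisor_add, h]
  -- Every edge meeting `R` has its `O`-head in `R`, so `O` maximises the number of heads in `R`.
  have hsubset : {f | f ∈ E(H) ∧ O' f ∈ R} ⊆ {f | f ∈ E(H) ∧ O f ∈ R} := by
    rintro f ⟨hf, hfR⟩
    refine ⟨hf, ?_⟩
    by_cases hfX : f ∈ edgeBoundary H R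
    · exact hO.head_mem_reachable hfX
    · exact mem_of_inc_of_notMem_edgeBoundary hfX (hO' f hf) (hO f hf) hfR
  have heq := Set.eq_of_subset_of_ncard_le hsubset
    (ncard_setOf_head_mem_eq hE hE hheads R).ge (hE.subset fun f hf => hf.1)
  refine reachable_subset (mem_reachable_self H O q) fun f x y hf hy hx => ?_
  by_contra hyR
  have hfX : f ∈ edgeBoundary H R := ⟨x, hx, y, hyR, hf⟩
  have hmem : f ∈ {f | f ∈ E(H) ∧ O' f ∈ R} := heq ▸ ⟨hf.edge_mem, hO.head_mem_reachable hfX⟩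
  exact hyR (hy ▸ hmem.2)

theorem reachable_eq_of_orientationDivisor_eq (hE : E(H).Finite) (hO : IsOrientation H O)
    (hO' : IsOrientation H O') (h : orientationDivisor H O = orientationDivisor H O') (q : V) :
    reachable H O q = reachable H O' q :=
  (reachable_subset_of_orientationDivisor_eq hE hO' hO h.symm q).antisymm
    (reachable_subset_of_orientationDivisor_eq hE hO hO' h q)

theorem isBreakDivisor_headDivisor (hT : IsSpanningTree H T)
    (hη : ∀ f ∈ E(H) \ T, H.Inc f (η f)) : IsBreakDivisor H (headDivisor η (E(H) \ T)) :=
  ⟨T, hT, η, hη, fun _ => rfl⟩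

theorem IsOrientation.isBreakDivisor_add_chip (hE : E(H).Finite) (hO : IsOrientation H O)
    (hq : q ∈ V(H)) (h : V(H) ⊆ reachable H O q) :
    IsBreakDivisor H (orientationDivisor H O + chip q) := by
  obtain ⟨T, hT, hbij⟩ := exists_isSpanningTree_bijOn hq h
  rw [hO.add_chip_eq_headDivisor hE hq hT.1 hbij]
  exact isBreakDivisor_headDivisor hT fun f hf => hO f hf.1

theorem IsBreakDivisor.exists_isOrientation (hE : E(H).Finite) {D : V → ℤ}
    (hD : IsBreakDivisor H D) (hq : q ∈ V(H)) :
    ∃ O, IsOrientation H O ∧ D = orientationDivisor H O + chip q ∧ V(H) ⊆ reachable H O q := by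
  obtain ⟨T, hT, η, hη, hDη⟩ := hD
  obtain ⟨O, hO, heq, hreach, -⟩ := hT.exists_isOrientation hE hη hq
  exact ⟨O, hO, (funext hDη).trans heq, hreach.trans (reachable_mono Graph.restrict_le)⟩

theorem IsOrientation.subset_reachable (hE : E(H).Finite) (hO : IsOrientation H O)
    (hq : q ∈ V(H)) (hD : IsBreakDivisor H (orientationDivisor H O + chip q)) :
    V(H) ⊆ reachable H O q := by
  obtain ⟨O', hO', heq, hreach⟩ := hD.exists_isOrientation hE hq
  rwa [reachable_eq_of_orientationDivisor_eq hE hO hO' (add_right_cancel heq)]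

end OrientationDivisor

section Cut

variable {O : E → V} {T : Set E} {X : Set V} {e : E} {u v q : V}

theorem IsOrientation.isBreakDivisor_deleteEdges (hE : E(H).Finite) (hO : IsOrientation H O)
    (he : H.IsLink e u v) (hv : v ∈ reachable H O u) (h : V(H) ⊆ reachable H O v) :
    IsBreakDivisor (H.deleteEdges {e}) (orientationDivisor H O) := by
  have hreach : V(H) ⊆ reachable H O (O e) := by
    obtain hOe | hOe := (hO e he.edge_mem).eq_or_eq_of_isLink he <;> rw [hOe]
    · exact h.trans (reachable_trans hv)
    · exact h
  have hle : H.deleteEdges {e} ≤ H := Graph.deleteEdges_le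
  rw [hO.eq_deleteEdges_add_chip hE he.edge_mem]
  refine (hO.mono hle).isBreakDivisor_add_chip (hE.subset hle.edgeSet_mono)
    (hO e he.edge_mem).vertex_mem (hreach.trans ?_)
  -- A directed path that uses `e` passes through `O e`, so its initial part can be dropped.
  refine reachable_subset (mem_reachable_self _ _ _) fun f x y hf hy hx => ?_
  by_cases hfe : f = e
  · rw [← hy, hfe]
    exact mem_reachable_self _ _ _
  · exact mem_reachable_of_isLink hx ⟨hf, hfe⟩ hy

theorem reachable_subset_reachable_induce (H : Graph V E) (O : E → V) (q : V) :
    reachable H O q ⊆ reachable (H.induce (reachable H O q)) O q := by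
  intro x hx
  induction hx with
  | refl => exact mem_reachable_self _ _ _
  | tail hx h ih =>
    obtain ⟨f, hf, hO⟩ := h
    exact mem_reachable_of_isLink ih ⟨hf, hx, mem_reachable_of_isLink hx hf hO⟩ hO

theorem reachable_diff_subset_reachable_induce (H : Graph V E) (O : E → V) (u v : V) :
    reachable H O v \ reachable H O u ⊆
      reachable (H.induce (V(H) \ reachable H O u)) O v := by
  rw [Set.sdiff_subset_iff]
  refine reachable_subset (.inr (mem_reachable_self _ _ _)) fun f x y hf hO hx => ?_
  by_cases hy : y ∈ reachable H O u
  · exact .inl hy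
  · have hxu : x ∉ reachable H O u := fun hxu => hy (mem_reachable_of_isLink hxu hf hO)
    exact .inr (mem_reachable_of_isLink (hx.resolve_left hxu)
      ⟨hf, ⟨hf.left_mem, hxu⟩, hf.right_mem, hy⟩ hO)

theorem IsOrientation.isBreakDivisor_induce_reachable (hE : E(H).Finite) (hO : IsOrientation H O)
    (hq : q ∈ V(H)) :
    IsBreakDivisor (H.induce (reachable H O q))
      (orientationDivisor (H.induce (reachable H O q)) O + chip q) := by
  have hle := Graph.induce_le (reachable_subset_vertexSet (O := O) hq)
  exact (hO.mono hle).isBreakDivisor_add_chip (hE.subset hle.edgeSet_mono)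
    (mem_reachable_self _ _ _) (reachable_subset_reachable_induce H O q)

theorem IsOrientation.isBreakDivisor_induce_diff_reachable (hE : E(H).Finite)
    (hO : IsOrientation H O) (hv : v ∈ V(H) \ reachable H O u) (h : V(H) ⊆ reachable H O v) :
    IsBreakDivisor (H.induce (V(H) \ reachable H O u))
      (orientationDivisor (H.induce (V(H) \ reachable H O u)) O + chip v) := by
  have hle : H.induce (V(H) \ reachable H O u) ≤ H := Graph.induce_le Set.sdiff_subset
  exact (hO.mono hle).isBreakDivisor_add_chip (hE.subset hle.edgeSet_mono) hv
    ((Set.sdiff_subset_sdiff_left h).trans (reachable_diff_subset_reachable_induce H O u v))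

theorem IsOrientation.add_chip_eq_of_mem_edgeBoundary (hE : E(H).Finite) (hO : IsOrientation H O)
    (he : e ∈ edgeBoundary H (reachable H O u)) (heu : H.Inc e u) (v : V) :
    orientationDivisor H O + chip v =
      orientationDivisor (H.induce (reachable H O u)) O + chip u +
      (orientationDivisor (H.induce (V(H) \ reachable H O u)) O + chip v) +
      headDivisor O (edgeBoundary H (reachable H O u) \ {e}) := by
  have hu := mem_reachable_self H O u
  have hOe : O e = u := eq_of_inc_of_mem_edgeBoundary he (hO e heu.edge_mem) heu
    (iff_of_true (hO.head_mem_reachable he) hu)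
  have hheads := headDivisor_diff_add (η := O) (hE.subset (edgeBoundary_subset H _))
    (Set.singleton_subset_iff.2 he)
  rw [headDivisor_singleton, hOe] at hheads
  linear_combination
    hO.eq_induce_add_induce_add hE (reachable_subset_vertexSet heu.vertex_mem) - hheads

theorem IsOrientation.reachable_eq_of_inter_edgeBoundary_eq (hO : IsOrientation H O)
    (hX : X ⊆ V(H)) (hcut : T ∩ edgeBoundary H X = {e}) (hu : u ∈ X) (heu : H.Inc e u)
    (hv : v ∉ X) (hreach : V(H) ⊆ reachable (H.restrict T) O v)
    (hin : ∀ f ∈ edgeBoundary H X \ {e}, O f ∈ X) : reachable H O u = X := by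
  have heX : e ∈ edgeBoundary H X := (hcut.ge rfl).2
  have eq_of_enters {f x y} (hf : (H.restrict T).IsLink f x y) (hx : x ∉ X) (hy : y ∈ X) : f = e :=
    hcut.le ⟨hf.1, y, hy, x, hx, hf.2.symm⟩
  -- Since `u` can be reached from `v`, some edge of `T` enters `X`, and that edge must be `e`.
  have hOeX : O e ∈ X := by
    by_contra hOeX
    have hsub : reachable (H.restrict T) O v ⊆ Xᶜ := reachable_subset hv fun f x y hf hOf hx hy =>
      hOeX (eq_of_enters hf hx hy ▸ hOf ▸ hy)
    exact hsub (hreach (hX hu)) hu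
  have hOe : O e = u := eq_of_inc_of_mem_edgeBoundary heX (hO e heu.edge_mem) heu
    (iff_of_true hOeX hu)
  refine (reachable_subset hu fun f x y hf hOf hx => ?_).antisymm fun x hx => ?_
  · by_contra hy
    obtain rfl | hfe := eq_or_ne f e
    · exact hy (hOf ▸ hOeX)
    · exact hy (hOf ▸ hin f ⟨⟨x, hx, y, hy, hf⟩, hfe⟩)
  · suffices h : reachable (H.restrict T) O v ⊆ {x | x ∈ X → x ∈ reachable H O u} from
      h (hreach (hX hx)) hx
    refine reachable_subset (fun h => absurd h hv) fun f x y hf hOf hx hy => ?_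
    by_cases hxX : x ∈ X
    · exact mem_reachable_of_isLink (hx hxX) hf.2 hOf
    · rw [← hOf, eq_of_enters hf hxX hy, hOe]
      exact mem_reachable_self H O u

end Cut

theorem edgeBoundary_restrict_insert_subset {T : Set E} {X : Set V} {e : E}
    (hcut : T ∩ edgeBoundary H X = {e}) (f : E) :
    edgeBoundary (H.restrict (insert f T)) X ⊆ {e, f} := by
  rw [edgeBoundary_restrict]
  rintro g ⟨rfl | hgT, hg⟩
  · exact .inr rfl
  · exact .inl (hcut.le ⟨hgT, hg⟩)

theorem IsSpanningTree.range_edge_subset {T : Set E} (hT : IsSpanningTree H T) {f : E}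
    (C C' : DirectedCycle (H.restrict (insert f T))) (hf : f ∈ Set.range C.edge)
    (hf' : f ∈ Set.range C'.edge) : Set.range C.edge ⊆ Set.range C'.edge := by
  intro g hg
  obtain rfl | hgf := eq_or_ne g f
  · exact hf'
  obtain ⟨hgT, hgH⟩ := (C.range_edge_subset hg).symm
  replace hgT := hgT.resolve_left hgf
  obtain ⟨x, y, hxy⟩ := Graph.exists_isLink_of_mem_edgeSet hgH
  obtain ⟨X, -, -, -, hcut⟩ := hT.exists_inter_edgeBoundary_eq hxy hgT
  have hX := edgeBoundary_restrict_insert_subset hcut f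
  have hgX : g ∈ edgeBoundary (H.restrict (insert f T)) X := by
    rw [edgeBoundary_restrict]
    exact ⟨.inr hgT, (hcut.ge rfl).2⟩
  -- The cycle `C` crosses the fundamental cut of `g` a second time, which can only be at `f`.
  have hfX := (C.mem_range_edge_of_edgeBoundary_subset hX ⟨hg, hgX⟩).2
  rw [Set.pair_comm] at hX
  exact (C'.mem_range_edge_of_edgeBoundary_subset hX ⟨hf', hfX⟩).1

theorem restrict_deleteEdges {T : Set E} {e : E} (he : e ∉ T) :
    (H.deleteEdges {e}).restrict T = H.restrict T := by
  refine Graph.ext rfl fun f x y => ?_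
  simp only [Graph.restrict_isLink, Graph.deleteEdges_isLink, Set.mem_singleton_iff]
  exact and_congr_right fun hf => and_iff_left fun hfe => he (hfe ▸ hf)

theorem isSpanningTree_deleteEdges_iff {T : Set E} {e : E} (he : e ∉ T) :
    IsSpanningTree (H.deleteEdges {e}) T ↔ IsSpanningTree H T := by
  rw [IsSpanningTree, IsSpanningTree, restrict_deleteEdges he, Graph.edgeSet_deleteEdges,
    Set.subset_sdiff, Set.disjoint_singleton_right, and_iff_left he]

namespace EdgeOrder

variable {data : EdgeOrder G} {S T : Set E} {X : Set V} {f : E} {i : Fin data.h} {x y q : V}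

theorem exists_isSmallest (h : ∃ j, data.e j ∈ S) : ∃ i, data.IsSmallest S i :=
  ⟨wellFounded_lt.min {j | data.e j ∈ S} h, wellFounded_lt.min_mem _ h,
    fun _ hj => not_lt.1 (wellFounded_lt.not_lt_min _ hj)⟩

theorem IsSmallest.eq_of_subset (hi : data.IsSmallest S i) (hj : data.IsSmallest T j)
    (hTS : T ⊆ S) (hiT : data.e i ∈ T) : i = j :=
  le_antisymm (hi.2 (hTS hj.1)) (hj.2 hiT)

theorem IsSmallest.isLink (hi : data.IsSmallest E(H) i) (hHG : H ≤ G) :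
    H.IsLink (data.e i) (data.u i) (data.v i) :=
  (hHG.isLink_iff hi.1).2 (data.isLink i)

theorem exists_orients (hHG : H ≤ G) (hT : IsSpanningTree H T) (hf : f ∈ E(H) \ T) :
    ∃ x, data.Orients H T f x := by
  obtain ⟨C, k, hk⟩ := hT.exists_directedCycle hf
  have hlink (j) : G.IsLink (C.edge j) (C.vert j) (C.vert (j + 1)) := (C.isLink j).2.mono hHG
  have meets_complement : ∃ i, data.e i ∈ Set.range C.edge := by
    by_contra! h
    refine data.isForest.2.false (C.transfer fun j => ⟨by_contra fun hj => ?_, hlink j⟩)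
    obtain ⟨i, hi⟩ := data.range_e.ge ⟨(hlink j).edge_mem, hj⟩
    exact h i ⟨j, hi.symm⟩
  obtain ⟨i, hi⟩ := exists_isSmallest meets_complement
  obtain ⟨j, hj⟩ := hi.1
  obtain ⟨hu, hv⟩ | ⟨hv, hu⟩ := (hj ▸ hlink j).eq_and_eq_or_eq_and_eq (data.isLink i)
  · exact ⟨_, C, ⟨i, hi, j, hj, hu, hv⟩, k, hk, rfl⟩
  · obtain ⟨j', hj', hvert, hvert'⟩ := C.exists_reverse_eq j
    obtain ⟨k', hk', -⟩ := C.exists_reverse_eq k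
    exact ⟨_, C.reverse, ⟨i, C.range_reverse_edge ▸ hi, j', hj'.trans hj, hvert.trans hu,
      hvert'.trans hv⟩, k', hk'.trans hk, rfl⟩

theorem exists_isSmallest_of_notMem (hHG : H ≤ G) (hT : IsSpanningTree H T)
    (hf : f ∈ E(H) \ T) : ∃ i, data.IsSmallest E(H) i := by
  obtain ⟨x, C, ⟨i, hi, -⟩, -⟩ := exists_orients (data := data) hHG hT hf
  exact exists_isSmallest ⟨i, (C.range_edge_subset hi.1).1⟩

theorem eq_edgeSet_of_forall_not_isSmallest (hHG : H ≤ G) (hT : IsSpanningTree H T)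
    (h : ∀ i, ¬data.IsSmallest E(H) i) : T = E(H) :=
  hT.1.antisymm fun _ hf => by_contra fun hfT =>
    not_exists.2 h (exists_isSmallest_of_notMem hHG hT ⟨hf, hfT⟩)

namespace Orients

theorem inc (h : data.Orients H T f x) : H.Inc f x := by
  obtain ⟨C, -, k, hk, rfl⟩ := h
  have hinc := (C.isLink k).2.inc_right
  rwa [hk] at hinc

theorem eq_v (hi : data.IsSmallest E(H) i) (h : data.Orients H T (data.e i) x) :
    x = data.v i := by
  obtain ⟨C, ⟨i', hi', j, hj, -, hv⟩, k, hk, rfl⟩ := h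
  obtain rfl := hi.eq_of_subset hi' (fun f hf => (C.range_edge_subset hf).1) ⟨k, hk⟩
  rw [C.edge_injective (hk.trans hj.symm), hv]

theorem mem_of_inter_edgeBoundary_eq (hi : data.IsSmallest E(H) i)
    (hcut : T ∩ edgeBoundary H X = {data.e i}) (hu : data.u i ∈ X)
    (hf : f ∈ edgeBoundary H X) (h : data.Orients H T f x) : x ∈ X := by
  obtain ⟨C, ⟨i', hi', j, hj, hju, hjv⟩, k, hk, rfl⟩ := h
  have hX := edgeBoundary_restrict_insert_subset hcut f
  have hfX : f ∈ edgeBoundary (H.restrict (insert f T)) X := by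
    rw [edgeBoundary_restrict]
    exact ⟨.inl rfl, hf⟩
  have hmem := C.mem_range_edge_of_edgeBoundary_subset (Set.pair_comm _ _ ▸ hX) ⟨⟨k, hk⟩, hfX⟩
  obtain rfl := hi.eq_of_subset hi' (fun f hf => (C.range_edge_subset hf).1) hmem.1
  have hleaves := (C.mem_edgeBoundary_iff j).1 (hj ▸ hmem.2)
  obtain ⟨k', hk', -, hmem'⟩ := C.exists_enters_of_leaves hX hj (hju ▸ hu)
    (hleaves.1 (hju ▸ hu))
  rwa [C.edge_injective (hk.trans hk'.symm)]

theorem unique (hT : IsSpanningTree H T) (hx : data.Orients H T f x)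
    (hy : data.Orients H T f y) : x = y := by
  have hxinc := hx.inc
  have hyinc := hy.inc
  obtain ⟨C, ⟨i, hi, j, hj, hju, hjv⟩, k, hk, rfl⟩ := hx
  obtain ⟨C', ⟨i', hi', j', hj', hju', hjv'⟩, k', hk', rfl⟩ := hy
  rw [(hT.range_edge_subset C C' ⟨k, hk⟩ ⟨k', hk'⟩).antisymm
    (hT.range_edge_subset C' C ⟨k', hk'⟩ ⟨k, hk⟩)] at hi
  obtain rfl := IsLeast.unique hi hi'
  by_cases hif : data.e i = f
  · rw [C.edge_injective (hk.trans (hif.symm.trans hj.symm)),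
      C'.edge_injective (hk'.trans (hif.symm.trans hj'.symm)), hjv, hjv']
  -- Both cycles leave the fundamental cut of `e i` through `e i`, so they return through `f`.
  · have hlink := C.isLink j
    rw [hj, hju, hjv] at hlink
    obtain ⟨X, -, hu, hv, hcut⟩ :=
      hT.exists_inter_edgeBoundary_eq hlink.2 (hlink.1.resolve_left hif)
    have hX := edgeBoundary_restrict_insert_subset hcut f
    obtain ⟨l, hl, -, hmem⟩ := C.exists_enters_of_leaves hX hj (hju ▸ hu) (hjv ▸ hv)
    obtain ⟨l', hl', -, hmem'⟩ := C'.exists_enters_of_leaves hX hj' (hju' ▸ hu) (hjv' ▸ hv)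
    obtain rfl := C.edge_injective (hk.trans hl.symm)
    obtain rfl := C'.edge_injective (hk'.trans hl'.symm)
    have heX := (hcut.ge rfl).2
    have hfX : f ∈ edgeBoundary H X := by
      have h := C.mem_range_edge_of_edgeBoundary_subset hX
        ⟨⟨j, hj⟩, edgeBoundary_restrict H _ X ▸ ⟨hlink.1, heX⟩⟩
      rw [edgeBoundary_restrict] at h
      exact h.2.2
    exact eq_of_inc_of_mem_edgeBoundary hfX hxinc hyinc (iff_of_true hmem hmem')

theorem of_induce (hST : S ⊆ T) (h : data.Orients (H.induce X) S f x) :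
    data.Orients H T f x := by
  obtain ⟨C, hC, hf⟩ := h
  exact ⟨C.transfer fun j => ⟨Set.insert_subset_insert hST (C.isLink j).1, (C.isLink j).2.1⟩,
    hC, hf⟩

end Orients

theorem exists_heads (hHG : H ≤ G) (hT : IsSpanningTree H T) :
    ∃ η : E → V, ∀ f ∈ E(H) \ T, data.Orients H T f (η f) := by
  have : Nonempty V := ⟨hT.2.1.1.choose⟩
  choose! η hη using fun f => exists_orients (data := data) (f := f) hHG hT
  exact ⟨η, hη⟩

theorem edgeOrderingMap_eq_headDivisor (hT : IsSpanningTree H T) {η : E → V}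
    (hη : ∀ f ∈ E(H) \ T, data.Orients H T f (η f)) :
    data.edgeOrderingMap H T = headDivisor η (E(H) \ T) := by
  ext x
  refine congrArg (fun A : Set E => (A.ncard : ℤ)) (Set.ext fun f => and_congr_right fun hf => ?_)
  exact ⟨fun h => (hη f hf).unique hT h, fun h => h ▸ hη f hf⟩

theorem isBreakDivisor_edgeOrderingMap (hHG : H ≤ G) (hT : IsSpanningTree H T) :
    IsBreakDivisor H (data.edgeOrderingMap H T) := by
  obtain ⟨η, hη⟩ := exists_heads (data := data) hHG hT
  rw [edgeOrderingMap_eq_headDivisor hT hη]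
  exact isBreakDivisor_headDivisor hT fun f hf => (hη f hf).inc

theorem support_edgeOrderingMap_subset (hHG : H ≤ G) (hT : IsSpanningTree H T) :
    Function.support (data.edgeOrderingMap H T) ⊆ V(H) := by
  obtain ⟨η, hη⟩ := exists_heads (data := data) hHG hT
  rw [edgeOrderingMap_eq_headDivisor hT hη]
  exact support_headDivisor_subset fun f hf => (hη f hf).inc.vertex_mem

theorem edgeOrderingMap_edgeSet (data : EdgeOrder G) (H : Graph V E) :
    data.edgeOrderingMap H E(H) = 0 := by
  ext x
  simp [edgeOrderingMap]

theorem edgeOrderingMap_deleteEdges (hHG : H ≤ G) (hE : E(H).Finite)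
    (hT : IsSpanningTree H T) (hi : data.IsSmallest E(H) i) (hiT : data.e i ∉ T) :
    data.edgeOrderingMap H T =
      data.edgeOrderingMap (H.deleteEdges {data.e i}) T + chip (data.v i) := by
  obtain ⟨η, hη⟩ := exists_heads (data := data) hHG hT
  have hη' : ∀ f ∈ E(H.deleteEdges {data.e i}) \ T,
      data.Orients (H.deleteEdges {data.e i}) T f (η f) := by
    intro f hf
    have hiT' : data.e i ∉ insert f T := fun h => h.elim (fun h => hf.1.2 h.symm) hiT
    rw [Orients, restrict_deleteEdges hiT']
    exact hη f ⟨hf.1.1, hf.2⟩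
  have hdiff := headDivisor_diff_add (η := η) hE.sdiff
    (Set.singleton_subset_iff.2 (⟨hi.1, hiT⟩ : data.e i ∈ E(H) \ T))
  rw [edgeOrderingMap_eq_headDivisor hT hη,
    edgeOrderingMap_eq_headDivisor ((isSpanningTree_deleteEdges_iff hiT).2 hT) hη', ← hdiff,
    headDivisor_singleton, (hη _ ⟨hi.1, hiT⟩).eq_v hi, Graph.edgeSet_deleteEdges,
    Set.sdiff_sdiff_comm]

theorem edgeOrderingMap_induce (hHG : H ≤ G) (hT : IsSpanningTree H T) (hX : X ⊆ V(H))
    (hTX : IsSpanningTree (H.induce X) (T ∩ E(H.induce X))) {η : E → V}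
    (hη : ∀ f ∈ E(H) \ T, data.Orients H T f (η f)) :
    data.edgeOrderingMap (H.induce X) (T ∩ E(H.induce X)) =
      headDivisor η (E(H.induce X) \ T) := by
  have hle : H.induce X ≤ H := Graph.induce_le hX
  obtain ⟨θ, hθ⟩ := exists_heads (data := data) (hle.trans hHG) hTX
  rw [edgeOrderingMap_eq_headDivisor hTX hθ, Set.inter_comm, Set.sdiff_self_inter]
  rw [Set.inter_comm, Set.sdiff_self_inter] at hθ
  exact headDivisor_congr fun f hf =>
    ((hθ f hf).of_induce Set.inter_subset_right).unique hT (hη f ⟨hle.edgeSet_mono hf.1, hf.2⟩)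

theorem edgeOrderingMap_eq_of_inter_edgeBoundary_eq (hHG : H ≤ G) (hE : E(H).Finite)
    (hT : IsSpanningTree H T) (hi : data.IsSmallest E(H) i) (hX : X ⊆ V(H))
    (hcut : T ∩ edgeBoundary H X = {data.e i}) (hu : data.u i ∈ X) {θ : E → V}
    (hθ : ∀ f ∈ edgeBoundary H X, H.Inc f (θ f) ∧ θ f ∈ X) :
    data.edgeOrderingMap H T =
      data.edgeOrderingMap (H.induce X) (T ∩ E(H.induce X)) +
      data.edgeOrderingMap (H.induce (V(H) \ X)) (T ∩ E(H.induce (V(H) \ X))) +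
      headDivisor θ (edgeBoundary H X \ {data.e i}) := by
  obtain ⟨η, hη⟩ := exists_heads (data := data) hHG hT
  have heq : Set.EqOn η θ (edgeBoundary H X \ T) := fun f hf => by
    have horients := hη f ⟨(hθ f hf.1).1.edge_mem, hf.2⟩
    exact eq_of_inc_of_mem_edgeBoundary hf.1 horients.inc (hθ f hf.1).1
      (iff_of_true (horients.mem_of_inter_edgeBoundary_eq hi hcut hu hf.1) (hθ f hf.1).2)
  have hboundary : edgeBoundary H X \ {data.e i} = edgeBoundary H X \ T := by
    rw [← hcut, Set.sdiff_inter_self_eq_sdiff]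
  rw [edgeOrderingMap_eq_headDivisor hT hη,
    edgeOrderingMap_induce hHG hT hX (hT.induce hX hcut) hη,
    edgeOrderingMap_induce hHG hT Set.sdiff_subset (hT.induce_diff hcut) hη, hboundary,
    ← headDivisor_congr heq]
  exact headDivisor_edgeSet_diff_eq hE η X T

theorem exists_isOrientation_orients (hHG : H ≤ G) (hE : E(H).Finite) (hT : IsSpanningTree H T)
    (hq : q ∈ V(H)) :
    ∃ O, IsOrientation H O ∧ data.edgeOrderingMap H T = orientationDivisor H O + chip q ∧
      V(H) ⊆ reachable (H.restrict T) O q ∧ ∀ f ∈ E(H) \ T, data.Orients H T f (O f) := by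
  obtain ⟨η, hη⟩ := exists_heads (data := data) hHG hT
  obtain ⟨O, hO, hD, hreach, hOη⟩ := hT.exists_isOrientation hE (fun f hf => (hη f hf).inc) hq
  exact ⟨O, hO, (edgeOrderingMap_eq_headDivisor hT hη).trans hD, hreach,
    fun f hf => (hOη hf).symm ▸ hη f hf⟩

theorem v_mem_reachable_of_notMem (hHG : H ≤ G) (hE : E(H).Finite) (hT : IsSpanningTree H T)
    (hi : data.IsSmallest E(H) i) {O : E → V} (hO : IsOrientation H O)
    (hD : data.edgeOrderingMap H T = orientationDivisor H O + chip (data.v i))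
    (hiT : data.e i ∉ T) : data.v i ∈ reachable H O (data.u i) := by
  have he := hi.isLink hHG
  obtain ⟨O', hO', hD', -, horients⟩ :=
    exists_isOrientation_orients (data := data) hHG hE hT he.right_mem
  rw [reachable_eq_of_orientationDivisor_eq hE hO hO' (add_right_cancel (hD.symm.trans hD'))]
  exact mem_reachable_of_isLink (mem_reachable_self _ _ _) he ((horients _ ⟨hi.1, hiT⟩).eq_v hi)

theorem inter_edgeBoundary_reachable_eq_of_mem (hHG : H ≤ G) (hE : E(H).Finite)
    (hT : IsSpanningTree H T) (hi : data.IsSmallest E(H) i) {O : E → V} (hO : IsOrientation H O)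
    (hD : data.edgeOrderingMap H T = orientationDivisor H O + chip (data.v i))
    (hiT : data.e i ∈ T) :
    T ∩ edgeBoundary H (reachable H O (data.u i)) = {data.e i} := by
  have he := hi.isLink hHG
  obtain ⟨O', hO', hD', hreach, horients⟩ :=
    exists_isOrientation_orients (data := data) hHG hE hT he.right_mem
  rw [reachable_eq_of_orientationDivisor_eq hE hO hO' (add_right_cancel (hD.symm.trans hD'))]
  obtain ⟨X, hX, hu, hv, hcut⟩ := hT.exists_inter_edgeBoundary_eq he hiT
  rwa [hO'.reachable_eq_of_inter_edgeBoundary_eq hX hcut hu he.inc_left hv hreach]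
  intro f hf
  have hfT : f ∉ T := fun hfT => hf.2 (hcut.le ⟨hfT, hf.1⟩)
  have horientsf := horients f ⟨edgeBoundary_subset H X hf.1, hfT⟩
  exact horientsf.mem_of_inter_edgeBoundary_eq hi hcut hu hf.1

theorem notMem_iff_v_mem_reachable (hHG : H ≤ G) (hE : E(H).Finite) (hT : IsSpanningTree H T)
    (hi : data.IsSmallest E(H) i) {O : E → V} (hO : IsOrientation H O)
    (hD : data.edgeOrderingMap H T = orientationDivisor H O + chip (data.v i)) :
    data.e i ∉ T ↔ data.v i ∈ reachable H O (data.u i) := by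
  refine ⟨v_mem_reachable_of_notMem hHG hE hT hi hO hD, fun hv hiT => ?_⟩
  have hcut := inter_edgeBoundary_reachable_eq_of_mem hHG hE hT hi hO hD hiT
  exact (mem_edgeBoundary_iff (hi.isLink hHG)).1 (hcut.ge rfl).2 |>.1 (mem_reachable_self _ _ _) hv

end EdgeOrder

theorem ncard_deleteEdges_lt (hE : E(H).Finite) {e : E} (he : e ∈ E(H)) :
    E(H.deleteEdges {e}).ncard < E(H).ncard :=
  Set.ncard_lt_ncard ⟨Graph.deleteEdges_le.edgeSet_mono, fun h => (h he).2 rfl⟩ hE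

theorem ncard_induce_lt (hE : E(H).Finite) {X : Set V} (hX : X ⊆ V(H)) {e : E}
    (he : e ∈ edgeBoundary H X) : E(H.induce X).ncard < E(H).ncard := by
  have heX := Set.disjoint_right.1 (disjoint_edgeSet_induce_edgeBoundary H X) he
  exact Set.ncard_lt_ncard ⟨(Graph.induce_le hX).edgeSet_mono,
    fun h => heX (h (edgeBoundary_subset H X he))⟩ hE

theorem indicator_add_eq_left {A B : V → ℤ} {X : Set V} (hA : Function.support A ⊆ X)
    (hB : Disjoint (Function.support B) X) : X.indicator (A + B) = A := by
  rw [Set.indicator_add', Set.indicator_eq_self.2 hA, Set.indicator_eq_zero'.2 hB, add_zero]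

theorem eq_and_eq_of_add_eq_add {A B A' B' : V → ℤ} {X Y : Set V} (hXY : Disjoint X Y)
    (hA : Function.support A ⊆ X) (hA' : Function.support A' ⊆ X) (hB : Function.support B ⊆ Y)
    (hB' : Function.support B' ⊆ Y) (h : A + B = A' + B') : A = A' ∧ B = B' := by
  have hAA' : A = A' := by
    rw [← indicator_add_eq_left hA (hXY.symm.mono_left hB), h,
      indicator_add_eq_left hA' (hXY.symm.mono_left hB')]
  exact ⟨hAA', add_left_cancel (hAA' ▸ h)⟩

theorem isSpanningTree_edgeSet_of_isBreakDivisor_zero (hE : E(H).Finite)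
    (h : IsBreakDivisor H 0) : IsSpanningTree H E(H) := by
  obtain ⟨T, hT, η, -, hη⟩ := h
  have hempty := eq_empty_of_headDivisor_eq_zero hE.sdiff (funext hη).symm
  rwa [← hT.1.antisymm (Set.sdiff_eq_empty.1 hempty)]

theorem exists_isDivisorToOrientation (hE : E(G).Finite) :
    ∃ sub, IsDivisorToOrientation G sub := by
  have exists_orientation (H : Graph V E) (D : V → ℤ) (q : V) :
      ∃ O : E → V, H ≤ G → IsBreakDivisor H D → q ∈ V(H) →
        IsOrientation H O ∧ D = orientationDivisor H O + chip q := by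
    by_cases h : H ≤ G ∧ IsBreakDivisor H D ∧ q ∈ V(H)
    · obtain ⟨hHG, hD, hq⟩ := h
      obtain ⟨O, hO, hDO, -⟩ := hD.exists_isOrientation (hE.subset hHG.edgeSet_mono) hq
      exact ⟨O, fun _ _ _ => ⟨hO, hDO⟩⟩
    · exact ⟨fun _ => q, fun hHG hD hq => absurd ⟨hHG, hD, hq⟩ h⟩
  choose sub hsub using exists_orientation
  exact ⟨sub, fun H hHG _ D hD q hq => hsub H D q hHG hD hq⟩

namespace EdgeOrder

variable {data : EdgeOrder G} {sub : Graph V E → (V → ℤ) → V → E → V} {D : V → ℤ} {S T : Set E}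
  {X : Set V} {i : Fin data.h}

theorem exists_isSmallest_of_isBreakDivisor (hHG : H ≤ G) (hD : IsBreakDivisor H D)
    (hD0 : D ≠ 0) : ∃ i, data.IsSmallest E(H) i := by
  obtain ⟨T, hT, η, -, hη⟩ := hD
  obtain ⟨f, hf⟩ : (E(H) \ T).Nonempty := by
    by_contra! hempty
    exact hD0 (funext fun x => by simp [hη, hempty])
  exact exists_isSmallest_of_notMem hHG hT hf

theorem outputs_zero (data : EdgeOrder G) (sub : Graph V E → (V → ℤ) → V → E → V)
    (H : Graph V E) : data.Outputs sub H 0 E(H) := by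
  refine ⟨1, fun n hn => ?_⟩
  obtain ⟨m, rfl⟩ := Nat.exists_eq_add_of_le' hn
  rw [inverse, if_pos rfl]

theorem inverse_succ_of_mem (hD : D ≠ 0) (hi : data.IsSmallest E(H) i)
    (hv : data.v i ∈ reachable H (sub H D (data.v i)) (data.u i)) (n : ℕ) :
    data.inverse sub (n + 1) H D =
      data.inverse sub n (H.deleteEdges {data.e i}) (D - chip (data.v i)) := by
  have h : ∃ i, data.IsSmallest E(H) i := ⟨i, hi⟩
  have hchoose : h.choose = i := IsLeast.unique h.choose_spec hi
  rw [inverse, if_neg hD, dif_pos h]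
  exact (if_pos (by rwa [hchoose])).trans (by simp only [hchoose])

theorem inverse_succ_of_notMem (hD : D ≠ 0) (hi : data.IsSmallest E(H) i) {O : E → V}
    (hO : sub H D (data.v i) = O) {U : Set V} (hU : reachable H O (data.u i) = U)
    (hv : data.v i ∉ U) (n : ℕ) :
    data.inverse sub (n + 1) H D =
      (data.inverse sub n (H.induce U) (U.indicator fun x =>
        D x - ({f | f ≠ data.e i ∧ ∃ w ∉ U, H.IsLink f w x ∧ O f = x}.ncard : ℤ))).bind
      fun TL => (data.inverse sub n (H.induce (V(H) \ U)) ((V(H) \ U).indicator D)).map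
        fun TR => {data.e i} ∪ TL ∪ TR := by
  have h : ∃ i, data.IsSmallest E(H) i := ⟨i, hi⟩
  have hchoose : h.choose = i := IsLeast.unique h.choose_spec hi
  subst hO hU
  rw [inverse, if_neg hD, dif_pos h]
  exact (if_neg (by rwa [hchoose])).trans (by simp only [hchoose])

namespace Outputs

theorem of_deleteEdges (hD : D ≠ 0) (hi : data.IsSmallest E(H) i)
    (hv : data.v i ∈ reachable H (sub H D (data.v i)) (data.u i))
    (hT : data.Outputs sub (H.deleteEdges {data.e i}) (D - chip (data.v i)) T) :
    data.Outputs sub H D T := by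
  obtain ⟨N, hN⟩ := hT
  refine ⟨N + 1, fun n hn => ?_⟩
  obtain ⟨m, rfl⟩ := Nat.exists_eq_add_of_le' (Nat.le_of_add_left_le hn)
  rw [inverse_succ_of_mem hD hi hv, hN m (Nat.le_of_succ_le_succ hn)]

theorem union (hD : D ≠ 0) (hi : data.IsSmallest E(H) i) {O : E → V} (hO : IsOrientation H O)
    (hsub : sub H D (data.v i) = O) {U : Set V} (hU : reachable H O (data.u i) = U)
    (hv : data.v i ∉ U) {A B : V → ℤ} (hA : Function.support A ⊆ U)
    (hB : Function.support B ⊆ V(H) \ U)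
    (h : D = A + B + headDivisor O (edgeBoundary H U \ {data.e i}))
    (hS : data.Outputs sub (H.induce U) A S) (hT : data.Outputs sub (H.induce (V(H) \ U)) B T) :
    data.Outputs sub H D ({data.e i} ∪ S ∪ T) := by
  have hhead : Set.MapsTo O (edgeBoundary H U) U := by
    subst hU
    exact fun f hf => hO.head_mem_reachable hf
  have hleft : (U.indicator fun x =>
      D x - ({f | f ≠ data.e i ∧ ∃ w ∉ U, H.IsLink f w x ∧ O f = x}.ncard : ℤ)) = A := by
    rw [← indicator_add_eq_left hA (Set.disjoint_sdiff_left.mono_left hB)]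
    refine Set.indicator_congr fun x hx => ?_
    have hentering : {f | f ≠ data.e i ∧ ∃ w ∉ U, H.IsLink f w x ∧ O f = x} =
        {f | f ∈ edgeBoundary H U \ {data.e i} ∧ O f = x} := by
      ext f
      refine ⟨fun ⟨hf, w, hw, hlink, hOf⟩ => ⟨⟨⟨x, hx, w, hw, hlink.symm⟩, hf⟩, hOf⟩, ?_⟩
      rintro ⟨⟨⟨y, -, w, hw, hlink⟩, hf⟩, rfl⟩
      have hOf := (hO f hlink.edge_mem).eq_or_eq_of_isLink hlink
      rw [← hOf.resolve_right fun h => hw (h ▸ hx)] at hlink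
      exact ⟨hf, w, hw, hlink.symm, rfl⟩
    simp only [hentering, h, headDivisor, Pi.add_apply, add_sub_cancel_right]
  have hright : (V(H) \ U).indicator D = B := by
    have hdisj : Disjoint (Function.support (A + headDivisor O (edgeBoundary H U \ {data.e i})))
        (V(H) \ U) :=
      Set.disjoint_sdiff_right.mono_left ((Function.support_add _ _).trans
        (Set.union_subset hA (support_headDivisor_subset (hhead.mono_left Set.sdiff_subset))))
    rw [h, add_right_comm, add_comm, indicator_add_eq_left hB hdisj]
  obtain ⟨M, hM⟩ := hS
  obtain ⟨N, hN⟩ := hT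
  refine ⟨max M N + 1, fun n hn => ?_⟩
  obtain ⟨m, rfl⟩ := Nat.exists_eq_add_of_le' (Nat.le_of_add_left_le hn)
  have hm := max_le_iff.1 (Nat.le_of_succ_le_succ hn)
  rw [inverse_succ_of_notMem hD hi hsub hU hv, hleft, hright, hM m hm.1, hN m hm.2]
  rfl

end Outputs

theorem edgeOrderingMap_union (hHG : H ≤ G) (hE : E(H).Finite) (hi : data.IsSmallest E(H) i)
    (hX : X ⊆ V(H)) (he : data.e i ∈ edgeBoundary H X) (hu : data.u i ∈ X)
    (hS : IsSpanningTree (H.induce X) S) (hT : IsSpanningTree (H.induce (V(H) \ X)) T)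
    {θ : E → V} (hθ : ∀ f ∈ edgeBoundary H X, H.Inc f (θ f) ∧ θ f ∈ X) :
    data.edgeOrderingMap H ({data.e i} ∪ S ∪ T) =
      data.edgeOrderingMap (H.induce X) S + data.edgeOrderingMap (H.induce (V(H) \ X)) T +
      headDivisor θ (edgeBoundary H X \ {data.e i}) := by
  have hcut := union_inter_edgeBoundary he hS.1 hT.1
  have hST := isSpanningTree_union hX he hS hT
  have hleft : S = ({data.e i} ∪ S ∪ T) ∩ E(H.induce X) :=
    hS.eq_of_subset (hST.induce hX hcut) fun f hf => ⟨.inl (.inr hf), hS.1 hf⟩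
  have hright : T = ({data.e i} ∪ S ∪ T) ∩ E(H.induce (V(H) \ X)) :=
    hT.eq_of_subset (hST.induce_diff hcut) fun f hf => ⟨.inr hf, hT.1 hf⟩
  rw [edgeOrderingMap_eq_of_inter_edgeBoundary_eq hHG hE hST hi hX hcut hu hθ, ← hleft, ← hright]

/-- The inverse algorithm terminates on `(H, D)`, and its output `T` is a spanning tree of `H` in
the fibre of the edge ordering map over `D`. -/
def OutputsPreimage (data : EdgeOrder G) (sub : Graph V E → (V → ℤ) → V → E → V) (H : Graph V E)
    (D : V → ℤ) (T : Set E) : Prop :=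
  data.Outputs sub H D T ∧ IsSpanningTree H T ∧ data.edgeOrderingMap H T = D

namespace OutputsPreimage

theorem of_deleteEdges (hHG : H ≤ G) (hE : E(H).Finite) (hD0 : D ≠ 0)
    (hi : data.IsSmallest E(H) i) {O : E → V} (hsub : sub H D (data.v i) = O)
    (hD : D = orientationDivisor H O + chip (data.v i))
    (hv : data.v i ∈ reachable H O (data.u i))
    (hT : data.OutputsPreimage sub (H.deleteEdges {data.e i}) (orientationDivisor H O) T) :
    data.OutputsPreimage sub H D T := by
  obtain ⟨hout, htree, hmap⟩ := hT
  have hiT : data.e i ∉ T := fun h => (htree.1 h).2 rfl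
  rw [isSpanningTree_deleteEdges_iff hiT] at htree
  rw [eq_sub_of_add_eq hD.symm] at hout
  exact ⟨.of_deleteEdges hD0 hi (hsub ▸ hv) hout, htree,
    by rw [edgeOrderingMap_deleteEdges hHG hE htree hi hiT, hmap, ← hD]⟩

theorem union (hHG : H ≤ G) (hE : E(H).Finite) (hD0 : D ≠ 0) (hi : data.IsSmallest E(H) i)
    {O : E → V} (hO : IsOrientation H O) (hsub : sub H D (data.v i) = O) {U : Set V}
    (hU : reachable H O (data.u i) = U) (he : data.e i ∈ edgeBoundary H U) {A B : V → ℤ}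
    (h : D = A + B + headDivisor O (edgeBoundary H U \ {data.e i}))
    (hS : data.OutputsPreimage sub (H.induce U) A S)
    (hT : data.OutputsPreimage sub (H.induce (V(H) \ U)) B T) :
    data.OutputsPreimage sub H D ({data.e i} ∪ S ∪ T) := by
  obtain ⟨houtS, htreeS, rfl⟩ := hS
  obtain ⟨houtT, htreeT, rfl⟩ := hT
  have hlink := hi.isLink hHG
  have hUV : U ⊆ V(H) := hU ▸ reachable_subset_vertexSet hlink.left_mem
  have hu : data.u i ∈ U := hU ▸ mem_reachable_self H O _
  have hv : data.v i ∉ U := ((mem_edgeBoundary_iff hlink).1 he).1 hu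
  have hhead : ∀ f ∈ edgeBoundary H U, H.Inc f (O f) ∧ O f ∈ U := by
    subst hU
    exact fun f hf => ⟨hO f (edgeBoundary_subset H _ hf), hO.head_mem_reachable hf⟩
  refine ⟨.union hD0 hi hO hsub hU hv
    (support_edgeOrderingMap_subset ((Graph.induce_le hUV).trans hHG) htreeS)
    (support_edgeOrderingMap_subset ((Graph.induce_le Set.sdiff_subset).trans hHG) htreeT)
    h houtS houtT, isSpanningTree_union hUV he htreeS htreeT, ?_⟩
  rw [edgeOrderingMap_union hHG hE hi hUV he hu htreeS htreeT hhead, h]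

end OutputsPreimage

theorem exists_outputsPreimage (hE : E(G).Finite) (hsub : IsDivisorToOrientation G sub)
    (hHG : H ≤ G) (hD : IsBreakDivisor H D) : ∃ T, data.OutputsPreimage sub H D T := by
  induction hn : E(H).ncard using Nat.strong_induction_on generalizing H D with
  | _ n ih =>
  subst hn
  have hEH : E(H).Finite := hE.subset hHG.edgeSet_mono
  obtain rfl | hD0 := eq_or_ne D 0
  · exact ⟨E(H), outputs_zero data sub H, isSpanningTree_edgeSet_of_isBreakDivisor_zero hEH hD,
      edgeOrderingMap_edgeSet data H⟩
  obtain ⟨T₀, hT₀, -⟩ := id hD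
  obtain ⟨i, hi⟩ := exists_isSmallest_of_isBreakDivisor (data := data) hHG hD hD0
  have he := hi.isLink hHG
  obtain ⟨hO, hDO⟩ := hsub H hHG hT₀.connected D hD (data.v i) he.right_mem
  generalize hOsub : sub H D (data.v i) = O at hO hDO
  have hreach : V(H) ⊆ reachable H O (data.v i) := hO.subset_reachable hEH he.right_mem (hDO ▸ hD)
  by_cases hv : data.v i ∈ reachable H O (data.u i)
  · obtain ⟨T, hT⟩ := ih _ (ncard_deleteEdges_lt hEH hi.1) (Graph.deleteEdges_le.trans hHG)
      (hO.isBreakDivisor_deleteEdges hEH he hv hreach) rfl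
    exact ⟨T, .of_deleteEdges hHG hEH hD0 hi hOsub hDO hv hT⟩
  · have hU := reachable_subset_vertexSet (O := O) he.left_mem
    have heU := (mem_edgeBoundary_iff he).2 (iff_of_true (mem_reachable_self H O _) hv)
    obtain ⟨S, hS⟩ := ih _ (ncard_induce_lt hEH hU heU) ((Graph.induce_le hU).trans hHG)
      (hO.isBreakDivisor_induce_reachable hEH he.left_mem) rfl
    obtain ⟨T, hT⟩ := ih _
      (ncard_induce_lt hEH Set.sdiff_subset (edgeBoundary_vertexSet_diff H _ ▸ heU))
      ((Graph.induce_le Set.sdiff_subset).trans hHG)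
      (hO.isBreakDivisor_induce_diff_reachable hEH ⟨he.right_mem, hv⟩ hreach) rfl
    have hsum := hO.add_chip_eq_of_mem_edgeBoundary hEH heU he.inc_left (data.v i)
    exact ⟨_, .union hHG hEH hD0 hi hO hOsub rfl heU (hDO.trans hsum) hS hT⟩

theorem edgeOrderingMap_induce_eq_of_inter_edgeBoundary_eq (hHG : H ≤ G) (hE : E(H).Finite)
    (hS : IsSpanningTree H S) (hT : IsSpanningTree H T)
    (h : data.edgeOrderingMap H S = data.edgeOrderingMap H T) (hi : data.IsSmallest E(H) i)
    (hX : X ⊆ V(H)) (hcutS : S ∩ edgeBoundary H X = {data.e i})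
    (hcutT : T ∩ edgeBoundary H X = {data.e i}) (hu : data.u i ∈ X) {θ : E → V}
    (hθ : ∀ f ∈ edgeBoundary H X, H.Inc f (θ f) ∧ θ f ∈ X) :
    data.edgeOrderingMap (H.induce X) (S ∩ E(H.induce X)) =
        data.edgeOrderingMap (H.induce X) (T ∩ E(H.induce X)) ∧
      data.edgeOrderingMap (H.induce (V(H) \ X)) (S ∩ E(H.induce (V(H) \ X))) =
        data.edgeOrderingMap (H.induce (V(H) \ X)) (T ∩ E(H.induce (V(H) \ X))) := by
  have hle := (Graph.induce_le hX).trans hHG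
  have hle' := (Graph.induce_le (Set.sdiff_subset (s := V(H)) (t := X))).trans hHG
  rw [edgeOrderingMap_eq_of_inter_edgeBoundary_eq hHG hE hS hi hX hcutS hu hθ,
    edgeOrderingMap_eq_of_inter_edgeBoundary_eq hHG hE hT hi hX hcutT hu hθ] at h
  exact eq_and_eq_of_add_eq_add Set.disjoint_sdiff_right
    (support_edgeOrderingMap_subset hle (hS.induce hX hcutS))
    (support_edgeOrderingMap_subset hle (hT.induce hX hcutT))
    (support_edgeOrderingMap_subset hle' (hS.induce_diff hcutS))
    (support_edgeOrderingMap_subset hle' (hT.induce_diff hcutT)) (add_right_cancel h)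

theorem edgeOrderingMap_injOn (hE : E(G).Finite) (hHG : H ≤ G) :
    Set.InjOn (data.edgeOrderingMap H) {T | IsSpanningTree H T} := by
  intro S hS T hT h
  induction hn : E(H).ncard using Nat.strong_induction_on generalizing H S T with
  | _ n ih =>
  subst hn
  rw [Set.mem_ofPred_eq] at hS hT
  have hEH : E(H).Finite := hE.subset hHG.edgeSet_mono
  by_cases! hsmallest : ∀ i, ¬data.IsSmallest E(H) i
  · rw [eq_edgeSet_of_forall_not_isSmallest hHG hS hsmallest,
      eq_edgeSet_of_forall_not_isSmallest hHG hT hsmallest]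
  obtain ⟨i, hi⟩ := hsmallest
  have he := hi.isLink hHG
  obtain ⟨O, hO, hDS, -⟩ := exists_isOrientation_orients (data := data) hHG hEH hS he.right_mem
  have hDT := h.symm.trans hDS
  have notMem_iff_S := notMem_iff_v_mem_reachable hHG hEH hS hi hO hDS
  have notMem_iff_T := notMem_iff_v_mem_reachable hHG hEH hT hi hO hDT
  by_cases hv : data.v i ∈ reachable H O (data.u i)
  · have hiS := notMem_iff_S.2 hv
    have hiT := notMem_iff_T.2 hv
    rw [edgeOrderingMap_deleteEdges hHG hEH hS hi hiS,
      edgeOrderingMap_deleteEdges hHG hEH hT hi hiT] at h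
    exact ih _ (ncard_deleteEdges_lt hEH hi.1) (Graph.deleteEdges_le.trans hHG)
      ((isSpanningTree_deleteEdges_iff hiS).2 hS) ((isSpanningTree_deleteEdges_iff hiT).2 hT)
      (add_right_cancel h) rfl
  · have hcutS := inter_edgeBoundary_reachable_eq_of_mem hHG hEH hS hi hO hDS
      (not_not.1 (mt notMem_iff_S.1 hv))
    have hcutT := inter_edgeBoundary_reachable_eq_of_mem hHG hEH hT hi hO hDT
      (not_not.1 (mt notMem_iff_T.1 hv))
    set U := reachable H O (data.u i)
    have hU : U ⊆ V(H) := reachable_subset_vertexSet he.left_mem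
    have heU : data.e i ∈ edgeBoundary H U := (hcutS.ge rfl).2
    have hhead : ∀ f ∈ edgeBoundary H U, H.Inc f (O f) ∧ O f ∈ U :=
      fun f hf => ⟨hO f (edgeBoundary_subset H U hf), hO.head_mem_reachable hf⟩
    obtain ⟨hleft, hright⟩ := edgeOrderingMap_induce_eq_of_inter_edgeBoundary_eq hHG hEH hS hT h hi
      hU hcutS hcutT (mem_reachable_self H O _) hhead
    rw [hS.eq_union_of_cut hcutS, hT.eq_union_of_cut hcutT,
      ih _ (ncard_induce_lt hEH hU heU) ((Graph.induce_le hU).trans hHG) (hS.induce hU hcutS)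
        (hT.induce hU hcutT) hleft rfl,
      ih _ (ncard_induce_lt hEH Set.sdiff_subset (edgeBoundary_vertexSet_diff H U ▸ heU))
        ((Graph.induce_le Set.sdiff_subset).trans hHG) (hS.induce_diff hcutS)
        (hT.induce_diff hcutT) hright rfl]

end EdgeOrder

end EdgeOrdering

theorem mainTheorem6_general {V E : Type*} {G : Graph V E} (hE : E(G).Finite)
    (data : EdgeOrdering.EdgeOrder G) :
    (∃ sub, EdgeOrdering.IsDivisorToOrientation G sub) ∧
    (∀ sub, EdgeOrdering.IsDivisorToOrientation G sub → ∀ H ≤ G,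
      (∀ D, EdgeOrdering.IsBreakDivisor H D →
        ∃ T, data.Outputs sub H D T ∧ EdgeOrdering.IsSpanningTree H T ∧
          data.edgeOrderingMap H T = D) ∧
      (∀ T, EdgeOrdering.IsSpanningTree H T →
        EdgeOrdering.IsBreakDivisor H (data.edgeOrderingMap H T) ∧
          data.Outputs sub H (data.edgeOrderingMap H T) T)) ∧
    (∀ H ≤ G, Set.BijOn (data.edgeOrderingMap H) {T | EdgeOrdering.IsSpanningTree H T}
      {D | EdgeOrdering.IsBreakDivisor H D}) := by
  have isBreakDivisor {H T} (hHG : H ≤ G) (hT : EdgeOrdering.IsSpanningTree H T) :=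
    EdgeOrdering.EdgeOrder.isBreakDivisor_edgeOrderingMap (data := data) hHG hT
  have injOn {H} (hHG : H ≤ G) :=
    EdgeOrdering.EdgeOrder.edgeOrderingMap_injOn (data := data) hE hHG
  have exists_output {sub H D} (hsub : EdgeOrdering.IsDivisorToOrientation G sub) (hHG : H ≤ G)
      (hD : EdgeOrdering.IsBreakDivisor H D) :=
    EdgeOrdering.EdgeOrder.exists_outputsPreimage (data := data) hE hsub hHG hD
  obtain ⟨sub₀, hsub₀⟩ := EdgeOrdering.exists_isDivisorToOrientation hE
  refine ⟨⟨sub₀, hsub₀⟩, fun sub hsub H hHG => ⟨fun D hD => exists_output hsub hHG hD,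
    fun T hT => ⟨isBreakDivisor hHG hT, ?_⟩⟩,
    fun H hHG => ⟨fun T hT => isBreakDivisor hHG hT, injOn hHG, fun D hD => ?_⟩⟩
  · obtain ⟨S, hout, hS, hST⟩ := exists_output hsub hHG (isBreakDivisor hHG hT)
    rwa [injOn hHG hS hT hST] at hout
  · obtain ⟨T, -, hT, hTD⟩ := exists_output hsub₀ hHG hD
    exact ⟨T, hT, hTD⟩

theorem mainTheorem6 {V E : Type*} (G : Graph V E) [G.Loopless]
    (hV : V(G).Finite) (hE : E(G).Finite) (data : EdgeOrdering.EdgeOrder G) :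
    (∃ sub, EdgeOrdering.IsDivisorToOrientation G sub) ∧
    (∀ sub, EdgeOrdering.IsDivisorToOrientation G sub →
      ∀ H ≤ G, EdgeOrdering.Connected H →
        (∀ D, EdgeOrdering.IsBreakDivisor H D →
          ∃ T, data.Outputs sub H D T ∧ EdgeOrdering.IsSpanningTree H T ∧
            data.edgeOrderingMap H T = D) ∧
        (∀ T, EdgeOrdering.IsSpanningTree H T →
          EdgeOrdering.IsBreakDivisor H (data.edgeOrderingMap H T) ∧
            data.Outputs sub H (data.edgeOrderingMap H T) T)) ∧
    (∀ H ≤ G, EdgeOrdering.Connected H →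
      Set.BijOn (data.edgeOrderingMap H) {T | EdgeOrdering.IsSpanningTree H T}
        {D | EdgeOrdering.IsBreakDivisor H D}) := by
  obtain ⟨exists_sub, inverts, bijOn⟩ := mainTheorem6_general hE data
  exact ⟨exists_sub, fun sub hsub H hHG _ => inverts sub hsub H hHG, fun H hHG _ => bijOn H hHG⟩
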